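/- Let $\mathsf H=\bigoplus_{i=1}^m\mathsf H_i$ be the Hilbert direct sum of $m$ separable real Hilbert spaces. Let $f:\mathsf H\to\mathbb R$ be convex and differentiable, let $g_i:\mathsf H_i\to\left]-\infty,+\infty\right]$ be proper, convex and lower semicontinuous for each $i\in[m]=\{1,\dots,m\}$, and put $F(\mathsf x)=f(\mathsf x)+\sum_{i=1}^m g_i(\mathsf x_i)$. Assume that there are $L_{\mathrm{res}}>0$ and $L_1,\dots,L_m\ge 0$ such that, for every $i\in[m]$ and every choice of the other blocks, the map $\mathsf x_i\mapsto\nabla f(\mathsf x)\in\mathsf H$ is $L_{\mathrm{res}}$-Lipschitz and the map $\mathsf x_i\mapsto\nabla_i f(\mathsf x)\in\mathsf H_i$ is $L_i$-Lipschitz, where $\nabla_i f$ is the $i$-th block of $\nabla f$. Assume that $F$ attains its minimum $F^*=\min F$. Let $(i_k)_{k\in\mathbb N}$ be i.i.d. $[m]$-valued random variables on a probability space with $\mathsf P(i_k=i)=\mathsf p_i>0$ for all $i\in[m]$, and set $\mathsf p_{\max}=\max_i\mathsf p_i$, $\mathsf p_{\min}=\min_i\mathsf p_i$. Let $\tau\in\mathbb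 N$, let $\mathsf d^k=(\mathsf d^k_1,\dots,\mathsf d^k_m)\in\mathbb N^m$ be deterministic delay vectors with $\max_i\mathsf d^k_i\le\min\{k,\tau\}$ for all $k\in\mathbb N$, let $\gamma_1,\dots,\gamma_m>0$, and let $x^0\in\mathsf H$ be deterministic. For $k=0,1,\dots$ let $$x^{k+1}_i=\begin{cases}\operatorname{prox}_{\gamma_i g_i}\bigl(x^k_i-\gamma_i\nabla_i f(\hat x^k)\bigr)&\text{if } i=i_k,\\ x^k_i&\text{if } i\ne i_k,\end{cases}\qquad \hat x^k=\bigl(x_1^{k-\mathsf d^k_1},\dots,x_m^{k-\mathsf d^k_m}\bigr),$$ where $\operatorname{prox}_{\varphi}(u)=\operatorname{argmin}_{v}\bigl(\varphi(v)+\tfrac12\|u-v\|^2\bigr)$. Assume that $$\delta:=\max_{i\in[m]}\Bigl(L_i\gamma_i+2\gamma_i\tau L_{\mathrm{res}}\frac{\mathsf p_{\max}}{\sqrt{\mathsf p_{\min}}}\Bigr)<2 .$$ Then the following hold. (i) There is an $\mathsf H$-valued random variable with values in $\operatorname{argmin}F$ to which $(x^k)_{k\in\mathbb N}$ converges weakly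 almost surely. (ii) Suppose in addition that $F(x^0)<+\infty$. Then, for every $k$, $F(x^k)$ is finite and integrable; moreover $\mathsf E[F(x^k)]-F^*=o(1/k)$, and for every integer $k\ge1$ $$\mathsf E[F(x^k)]-F^*\le\frac1k\Bigl(\frac{\operatorname{dist}_{\mathsf W}^2(x^0,\operatorname{argmin}F)}{2}+C\,\bigl(F(x^0)-F^*\bigr)\Bigr),$$ where $$C=\frac{\max\{1,(2-\delta)^{-1}\}}{\mathsf p_{\min}}-1+\frac{\tau}{\sqrt{\mathsf p_{\min}}\,(2-\delta)}\Bigl(1+\frac{\mathsf p_{\max}}{\sqrt{\mathsf p_{\min}}}\Bigr)$$ and $\operatorname{dist}_{\mathsf W}(\mathsf x,S)=\inf_{\mathsf z\in S}\bigl(\sum_{i=1}^m\frac{1}{\gamma_i\mathsf p_i}\|\mathsf x_i-\mathsf z_i\|^2\bigr)^{1/2}$. -/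

import Mathlib

open Filter Topology MeasureTheory ProbabilityTheory
open scoped NNReal Gradient

namespace AsyncFB

universe u

section Convex

variable {E : Type u}

/-- `φ : E → ]-∞, +∞]` is proper: it never takes the value `-∞` and it is not identically `+∞`. -/
def Proper (φ : E → EReal) : Prop :=
  (∀ x, φ x ≠ ⊥) ∧ ∃ x, φ x ≠ ⊤

/-- Convexity of an extended-real-valued function (used only for functions that omit `-∞`). -/
def ConvexFun [AddCommGroup E] [Module ℝ E] (φ : E → EReal) : Prop :=
  ∀ x y : E, ∀ a b : ℝ, 0 < a → 0 < b → a + b = 1 →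
    φ (a • x + b • y) ≤ (a : EReal) * φ x + (b : EReal) * φ y

/-- The set of global minimizers of `φ`. -/
def argmin (φ : E → EReal) : Set E :=
  {x | ∀ y, φ x ≤ φ y}

/-- `q` minimizes `y ↦ φ y + ‖x - y‖² / 2`. -/
def IsProx [NormedAddCommGroup E] (φ : E → EReal) (x q : E) : Prop :=
  q ∈ argmin fun y => φ y + ((‖x - y‖ ^ 2 / 2 : ℝ) : EReal)

/-- The proximity operator: `prox φ x` is the minimizer of `y ↦ φ y + ‖x - y‖² / 2`, which exists
and is unique when `φ` is proper, convex and lower semicontinuous on a Hilbert space. -/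
noncomputable def prox [NormedAddCommGroup E] (φ : E → EReal) (x : E) : E :=
  Classical.epsilon (IsProx φ x)

end Convex

section Blocks

variable {m : ℕ} {E : Fin m → Type u} [∀ i, NormedAddCommGroup (E i)]

/-- The vector `x` of the Hilbert direct sum with its `i`-th block replaced by `v`. -/
def setBlock (x : PiLp 2 E) (i : Fin m) (v : E i) : PiLp 2 E :=
  WithLp.toLp 2 (Function.update (WithLp.ofLp x) i v)

/-- The objective `F x = f x + ∑ i, g i (x i)`. -/
noncomputable def objective (f : PiLp 2 E → ℝ) (g : (i : Fin m) → E i → EReal)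
    (x : PiLp 2 E) : EReal :=
  (f x : EReal) + ∑ i, g i (x i)

/-- The minimal value `F* = min F`, as a real number. -/
noncomputable def minValue (F : PiLp 2 E → EReal) : ℝ :=
  (⨅ x, F x).toReal

/-- The norm `‖x‖_A = (∑ i, a i * ‖x i‖²)^(1/2)` of the operator `A = ⨁ i, a i • Id`. -/
noncomputable def weightedNorm (a : Fin m → ℝ) (x : PiLp 2 E) : ℝ :=
  √(∑ i, a i * ‖x i‖ ^ 2)

/-- The distance from `x` to `S` in the norm `‖·‖_A`. -/
noncomputable def weightedDist (a : Fin m → ℝ) (x : PiLp 2 E) (S : Set (PiLp 2 E)) : ℝ :=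
  ⨅ z : S, weightedNorm a (x - (z : PiLp 2 E))

/-- The inconsistently delayed point `(x₁^(k - d₁), …, x_m^(k - d_m))` of a sequence of vectors. -/
def delayed (x : ℕ → PiLp 2 E) (k : ℕ) (d : Fin m → ℕ) : PiLp 2 E :=
  WithLp.toLp 2 fun j => x (k - d j) j

/-- `x` is the sequence produced from `x0` by the asynchronous block-coordinate forward-backward
iteration with stepsizes `γ`, when block `i k` is updated at iteration `k` with delays `d k`:
`x^{k+1}` is `x^k` with its block `i = i k` replaced by
`prox_{γ i • g i} (x^k_i - γ i • ∇_i f (x^{k - d k}))`, where `∇_i f` is the `i`-th block of `∇f`. -/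
def IsAsyncFB [∀ i, InnerProductSpace ℝ (E i)] [∀ i, CompleteSpace (E i)]
    (f : PiLp 2 E → ℝ) (g : (i : Fin m) → E i → EReal) (γ : Fin m → ℝ) (d : ℕ → Fin m → ℕ)
    (x0 : PiLp 2 E) (i : ℕ → Fin m) (x : ℕ → PiLp 2 E) : Prop :=
  x 0 = x0 ∧ ∀ k, x (k + 1) = setBlock (x k) (i k)
    (prox (fun y => (γ (i k) : EReal) * g (i k) y)
      (x k (i k) - γ (i k) • (∇ f (delayed x k (d k))) (i k)))

end Blocks

section Constants

variable {m : ℕ}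

/-- The largest block probability. -/
noncomputable def pmax (p : Fin m → ℝ) : ℝ := ⨆ i, p i

/-- The smallest block probability. -/
noncomputable def pmin (p : Fin m → ℝ) : ℝ := ⨅ i, p i

/-- `δ = max_i (L_i γ_i + 2 γ_i τ L_res p_max / √p_min)`. -/
noncomputable def delta (L : Fin m → ℝ≥0) (Lres : ℝ≥0) (γ p : Fin m → ℝ) (τ : ℕ) : ℝ :=
  ⨆ i, ((L i : ℝ) * γ i + 2 * γ i * τ * Lres * (pmax p / √(pmin p)))

/-- The constant `C` of the rate, as a function of `δ`, the block probabilities and `τ`. -/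
noncomputable def rateConst (δ : ℝ) (p : Fin m → ℝ) (τ : ℕ) : ℝ :=
  max 1 (2 - δ)⁻¹ / pmin p - 1 + τ * (1 / (√(pmin p) * (2 - δ))) * (1 + pmax p / √(pmin p))

end Constants

end AsyncFB

/-!
The step-size condition leaves room for a Lyapunov functional that decreases in conditional
expectation. Let `x = x^k`, let `s_h = ‖x^{h+1} - x^h‖`, let `Q` be the sum of the last `τ` squares
`s_h²`, each weighted by the number of iterations for which it still matters
(`windowWeighted`), and let `c = p_max / √p_min`.

* The delayed point and the current one are joined by a path that changes one block at a time, with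
  steps no longer than the `s_h`. The blockwise Lipschitz condition therefore bounds both
  `‖∇f(x) - ∇f(x̂)‖` and the Bregman distance of `f` between `x` and `x̂` (`delayed_bound`).
* The block descent lemma and the variational inequality of the proximal point, averaged over the
  drawn block, show that `Ψ = F(x) + (L_res c / 2) Q` decreases in expectation; the weighted sum `Q`
  absorbs the delay error because it telescopes. The same inequality tested against a point `z`
  controls the squared distance to `z` in the norm with weights `1 / (γ_i p_i)`, and a combination
  `V` of this distance, the gap `Ψ - F(z)` and `Q` satisfies
  `E V^{k+1} ≤ V^k - (E Ψ^{k+1} - F(z))` (`lyapunov_arithmetic`, `one_step`, `expect_lyapunov_le`).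
  The coefficient of the gap in `V` is exactly the constant `C` of the rate.

For the rates these inequalities are integrated and summed: the expected gaps of `Ψ` are
nonincreasing and summable, and `F ≤ Ψ` (`integral_augmented_bound`). For weak convergence,
`V + Ψ - F(z)` is a nonnegative supermartingale with decrements `Ψ - F(z)`, so that almost surely
the distance to each minimizer converges and `F(x^k)` tends to the minimum
(`ae_tendsto_dist_and_objective`). Sublevel sets of `F` are weakly closed, so that weak cluster
points are minimizers, and Opial's argument over a countable dense set of minimizers gives the weak
limit (`exists_weak_limit_of_opial`). When `F(x^0) = +∞`, the supermartingale starts at time `N` on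
the event that `F(x^N)` is finite; these events exhaust the space because every block is drawn.

The iterate `x^k` is a function of the first `k` random indices, which take finitely many values.
Random variables are therefore handled as functionals of the index sequence, with `expect` as
conditional expectation, and measurability and integrability are automatic.
-/

namespace AsyncFB

/-! ### Extended-real-valued convex functions and the proximity operator -/

section Prox

variable {E : Type*}

theorem Proper.coe_toReal {φ : E → EReal} (hφ : Proper φ) {x : E} (hx : φ x ≠ ⊤) :
    ((φ x).toReal : EReal) = φ x :=
  EReal.coe_toReal hx (hφ.1 x)

theorem ConvexFun.ne_top_and_toReal_le [AddCommGroup E] [Module ℝ E] {φ : E → EReal}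
    (hφ : Proper φ) (hc : ConvexFun φ) {x y : E} (hx : φ x ≠ ⊤) (hy : φ y ≠ ⊤) {a b : ℝ}
    (ha : 0 < a) (hb : 0 < b) (hab : a + b = 1) :
    φ (a • x + b • y) ≠ ⊤ ∧
      (φ (a • x + b • y)).toReal ≤ a * (φ x).toReal + b * (φ y).toReal := by
  have h := hc x y a b ha hb hab
  rw [← hφ.coe_toReal hx, ← hφ.coe_toReal hy] at h
  have h' : φ (a • x + b • y) ≤ ((a * (φ x).toReal + b * (φ y).toReal : ℝ) : EReal) := by
    push_cast; exact h
  have htop : φ (a • x + b • y) ≠ ⊤ := ne_top_of_le_ne_top (EReal.coe_ne_top _) h'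
  refine ⟨htop, ?_⟩
  rw [← hφ.coe_toReal htop] at h'
  exact_mod_cast h'

theorem Proper.const_mul {φ : E → EReal} (hφ : Proper φ) {c : ℝ} (hc : 0 < c) :
    Proper fun x => (c : EReal) * φ x := by
  refine ⟨fun x => ?_, ?_⟩
  · rcases eq_or_ne (φ x) ⊤ with h | h
    · simp [h, EReal.coe_mul_top_of_pos hc]
    · beta_reduce
      rw [← hφ.coe_toReal h, ← EReal.coe_mul]; exact EReal.coe_ne_bot _
  · obtain ⟨x, hx⟩ := hφ.2
    refine ⟨x, ?_⟩
    beta_reduce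
    rw [← hφ.coe_toReal hx, ← EReal.coe_mul]; exact EReal.coe_ne_top _

theorem Proper.const_mul_ne_top_iff {φ : E → EReal} (hφ : Proper φ) {c : ℝ} (hc : 0 < c) {x : E} :
    (c : EReal) * φ x ≠ ⊤ ↔ φ x ≠ ⊤ := by
  constructor
  · intro h h'
    exact h (by rw [h', EReal.coe_mul_top_of_pos hc])
  · intro h
    rw [← hφ.coe_toReal h, ← EReal.coe_mul]; exact EReal.coe_ne_top _

theorem ConvexFun.const_mul [AddCommGroup E] [Module ℝ E] {φ : E → EReal}
    (hφ : Proper φ) (hc : ConvexFun φ) {c : ℝ} (hc0 : 0 < c) :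
    ConvexFun fun x => (c : EReal) * φ x := by
  intro x y a b ha hb hab
  simp only
  have hbot := (hφ.const_mul hc0).1
  rcases eq_or_ne (φ x) ⊤ with hx | hx
  · rw [hx, EReal.coe_mul_top_of_pos hc0, EReal.coe_mul_top_of_pos ha, EReal.top_add_of_ne_bot]
    · exact le_top
    · exact ((hφ.const_mul hc0).const_mul hb).1 y
  rcases eq_or_ne (φ y) ⊤ with hy | hy
  · rw [hy, EReal.coe_mul_top_of_pos hc0, EReal.coe_mul_top_of_pos hb, EReal.add_top_of_ne_bot]
    · exact le_top
    · exact ((hφ.const_mul hc0).const_mul ha).1 x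
  obtain ⟨h1, h2⟩ := hc.ne_top_and_toReal_le hφ hx hy ha hb hab
  rw [← hφ.coe_toReal hx, ← hφ.coe_toReal hy, ← hφ.coe_toReal h1]
  norm_cast
  nlinarith

theorem _root_.LowerSemicontinuous.ereal_const_mul [TopologicalSpace E] {φ : E → EReal}
    (hl : LowerSemicontinuous φ) {c : ℝ} (hc : 0 < c) :
    LowerSemicontinuous fun x => (c : EReal) * φ x := by
  have hc' : (0 : EReal) < c := by exact_mod_cast hc
  intro x t ht
  have ht' : t < (c : EReal) * φ x := ht
  rw [mul_comm, ← EReal.div_lt_iff hc' (EReal.coe_ne_top c)] at ht'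
  filter_upwards [hl x _ ht'] with y hy
  have hy' : t / c < φ y := hy
  rw [EReal.div_lt_iff hc' (EReal.coe_ne_top c), mul_comm] at hy'
  exact hy'

variable [NormedAddCommGroup E]

theorem IsProx.ne_top {φ : E → EReal} (hφ : Proper φ) {x q : E} (h : IsProx φ x q) :
    φ q ≠ ⊤ := by
  obtain ⟨z, hz⟩ := hφ.2
  intro hq
  have h1 := h z
  simp only [hq, EReal.top_add_coe, top_le_iff] at h1
  rw [← hφ.coe_toReal hz] at h1
  exact EReal.coe_ne_top _ (by rw [← h1]; norm_cast)

variable [InnerProductSpace ℝ E]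

/-- A proper convex lower semicontinuous function decreases at most linearly: it is bounded below
near a point of its domain, and convexity propagates this bound along rays. -/
theorem exists_linear_lower_bound {φ : E → EReal} (hφ : Proper φ) (hc : ConvexFun φ)
    (hl : LowerSemicontinuous φ) (x : E) :
    ∃ c A : ℝ, ∀ y, φ y ≠ ⊤ → c - A * ‖x - y‖ ≤ (φ y).toReal := by
  obtain ⟨z, hz⟩ := hφ.2
  have hlt : (((φ z).toReal - 1 : ℝ) : EReal) < φ z := by
    conv_rhs => rw [← hφ.coe_toReal hz]
    exact_mod_cast sub_one_lt _
  obtain ⟨r, hr, hball⟩ := Metric.eventually_nhds_iff.1 (hl z _ hlt)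
  have hloc : ∀ y, φ y ≠ ⊤ → dist y z < r → (φ z).toReal - 1 ≤ (φ y).toReal := by
    intro y hy hd
    have h : (((φ z).toReal - 1 : ℝ) : EReal) < φ y := hball hd
    rw [← hφ.coe_toReal hy] at h
    exact le_of_lt (by exact_mod_cast h)
  have hzy : ∀ y, φ y ≠ ⊤ → (φ z).toReal - 1 - 2 / r * ‖y - z‖ ≤ (φ y).toReal := by
    intro y hy
    rcases lt_or_ge (dist y z) r with hd | hd
    · have := hloc y hy hd
      have : 0 ≤ 2 / r * ‖y - z‖ := by positivity
      linarith
    · rw [dist_eq_norm] at hd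
      have hpos : 0 < ‖y - z‖ := hr.trans_le hd
      set t : ℝ := r / (2 * ‖y - z‖) with ht
      have ht0 : 0 < t := by positivity
      have ht1 : t < 1 := by
        rw [ht, div_lt_one (by positivity)]; linarith
      have hti : t * (2 / r * ‖y - z‖) = 1 := by
        rw [ht]; field_simp
      obtain ⟨h1, h2⟩ := hc.ne_top_and_toReal_le hφ hy hz ht0 (sub_pos.2 ht1) (by ring)
      have hdist : dist (t • y + (1 - t) • z) z < r := by
        have : t • y + (1 - t) • z - z = t • (y - z) := by
          rw [sub_smul, smul_sub, one_smul]; abel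
        rw [dist_eq_norm, this, norm_smul, Real.norm_of_nonneg ht0.le]
        have : t * ‖y - z‖ = r / 2 := by rw [ht]; field_simp
        linarith
      have h3 := hloc _ h1 hdist
      have h4 : 0 ≤ t * ((φ y).toReal - ((φ z).toReal - 1 - 2 / r * ‖y - z‖)) := by
        have : t * ((φ y).toReal - ((φ z).toReal - 1 - 2 / r * ‖y - z‖))
            = t * (φ y).toReal - t * (φ z).toReal + t + t * (2 / r * ‖y - z‖) := by ring
        rw [this, hti]; nlinarith
      exact sub_nonneg.1 (nonneg_of_mul_nonneg_right h4 ht0)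
  refine ⟨(φ z).toReal - 1 - 2 / r * ‖x - z‖, 2 / r, fun y hy => ?_⟩
  have h1 := hzy y hy
  have h2 : ‖y - z‖ ≤ ‖x - y‖ + ‖x - z‖ := by
    rw [show y - z = (x - z) - (x - y) by abel]
    exact (norm_sub_le _ _).trans (by linarith)
  have : 2 / r * ‖y - z‖ ≤ 2 / r * (‖x - y‖ + ‖x - z‖) := by gcongr
  linarith

/-- Existence of the proximal point: a minimizing sequence is Cauchy by the parallelogram law. -/
theorem exists_isProx [CompleteSpace E] {φ : E → EReal} (hφ : Proper φ) (hc : ConvexFun φ)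
    (hl : LowerSemicontinuous φ) (x : E) : ∃ q, IsProx φ x q := by
  set h : E → ℝ := fun y => (φ y).toReal + ‖x - y‖ ^ 2 / 2 with hh
  set S : Set ℝ := h '' {y | φ y ≠ ⊤} with hS
  obtain ⟨c, A, hcA⟩ := exists_linear_lower_bound hφ hc hl x
  have hbdd : BddBelow S := by
    refine ⟨c - A ^ 2 / 2, ?_⟩
    rintro _ ⟨y, hy, rfl⟩
    have := hcA y hy
    simp only [hh]
    nlinarith [sq_nonneg (A - ‖x - y‖)]
  have hne : S.Nonempty := by
    obtain ⟨z, hz⟩ := hφ.2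
    exact ⟨_, z, hz, rfl⟩
  set μ := sInf S with hμ
  have hle : ∀ y, φ y ≠ ⊤ → μ ≤ h y := fun y hy => csInf_le hbdd ⟨y, hy, rfl⟩
  have hseq : ∀ n : ℕ, ∃ y, φ y ≠ ⊤ ∧ h y < μ + 1 / ((n : ℝ) + 1) := by
    intro n
    obtain ⟨_, ⟨y, hy, rfl⟩, h2⟩ := exists_lt_of_csInf_lt hne
      (show sInf S < μ + 1 / ((n : ℝ) + 1) by
        rw [← hμ]; exact lt_add_of_pos_right _ (by positivity))
    exact ⟨y, hy, h2⟩
  choose y hy hyμ using hseq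
  have hmid : ∀ u v, φ u ≠ ⊤ → φ v ≠ ⊤ → ‖u - v‖ ^ 2 ≤ 4 * (h u - μ + (h v - μ)) := by
    intro u v hu hv
    obtain ⟨h1, h2⟩ := hc.ne_top_and_toReal_le hφ hu hv (a := 1 / 2) (b := 1 / 2)
      (by norm_num) (by norm_num) (by norm_num)
    have h3 := hle _ h1
    have h4 : x - ((1 / 2 : ℝ) • u + (1 / 2 : ℝ) • v) = (1 / 2 : ℝ) • ((x - u) + (x - v)) := by
      module
    have h5 : ‖x - ((1 / 2 : ℝ) • u + (1 / 2 : ℝ) • v)‖ ^ 2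
        = (1 / 4) * ‖(x - u) + (x - v)‖ ^ 2 := by
      rw [h4, norm_smul, mul_pow]; norm_num
    have h6 := parallelogram_law_with_norm ℝ (x - u) (x - v)
    have h7 : ‖(x - u) - (x - v)‖ = ‖u - v‖ := by
      rw [show (x - u) - (x - v) = -(u - v) by abel, norm_neg]
    rw [h7] at h6
    simp only [hh] at h3 ⊢
    rw [h5] at h3
    nlinarith
  have hcau : CauchySeq y := by
    have hb : Tendsto (fun N : ℕ => √(8 * (1 / ((N : ℝ) + 1)))) atTop (𝓝 0) := by
      have := (tendsto_one_div_add_atTop_nhds_zero_nat (𝕜 := ℝ)).const_mul 8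
      simpa using this.sqrt
    refine cauchySeq_of_le_tendsto_0 _ (fun n k N hn hk => ?_) hb
    rw [dist_eq_norm]
    apply Real.le_sqrt_of_sq_le
    have h1 := hmid _ _ (hy n) (hy k)
    have h2 := hyμ n
    have h3 := hyμ k
    have h4 : 1 / ((n : ℝ) + 1) ≤ 1 / ((N : ℝ) + 1) := by gcongr
    have h5 : 1 / ((k : ℝ) + 1) ≤ 1 / ((N : ℝ) + 1) := by gcongr
    linarith
  obtain ⟨q, hq⟩ := cauchySeq_tendsto_of_complete hcau
  have hqle : φ q ≤ ((μ - ‖x - q‖ ^ 2 / 2 : ℝ) : EReal) := by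
    refine EReal.le_of_forall_lt_iff_le.1 fun t ht => ?_
    by_contra hcon
    have ht2 : (t : EReal) < φ q := not_le.1 hcon
    have hev := hq.eventually (hl q _ ht2)
    have h1 : ∀ᶠ n : ℕ in atTop, t + ‖x - y n‖ ^ 2 / 2 ≤ μ + 1 / ((n : ℝ) + 1) := by
      filter_upwards [hev] with n hn
      have h2 := hyμ n
      rw [← hφ.coe_toReal (hy n)] at hn
      have h3 : t < (φ (y n)).toReal := by exact_mod_cast hn
      simp only [hh] at h2
      linarith
    have h2 : Tendsto (fun n => t + ‖x - y n‖ ^ 2 / 2) atTop (𝓝 (t + ‖x - q‖ ^ 2 / 2)) :=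
      (((tendsto_const_nhds.sub hq).norm.pow 2).div_const 2).const_add t
    have h3 : Tendsto (fun n : ℕ => μ + 1 / ((n : ℝ) + 1)) atTop (𝓝 (μ + 0)) :=
      tendsto_one_div_add_atTop_nhds_zero_nat.const_add μ
    have h4 := le_of_tendsto_of_tendsto h2 h3 h1
    have h5 : μ - ‖x - q‖ ^ 2 / 2 < t := by exact_mod_cast ht
    linarith
  have hqt : φ q ≠ ⊤ := ne_top_of_le_ne_top (EReal.coe_ne_top _) hqle
  refine ⟨q, fun z => ?_⟩
  rcases eq_or_ne (φ z) ⊤ with hz | hz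
  · simp only [hz, EReal.top_add_coe]; exact le_top
  · have h1 := hle z hz
    simp only
    rw [← hφ.coe_toReal hqt] at hqle ⊢
    rw [← hφ.coe_toReal hz]
    norm_cast at hqle ⊢
    simp only [hh] at h1
    linarith

theorem isProx_prox [CompleteSpace E] {φ : E → EReal} (hφ : Proper φ) (hc : ConvexFun φ)
    (hl : LowerSemicontinuous φ) (x : E) : IsProx φ x (prox φ x) :=
  Classical.epsilon_spec (exists_isProx hφ hc hl x)

/-- The variational inequality that characterizes the proximal point. -/
theorem IsProx.inner_le {φ : E → EReal} (hφ : Proper φ) (hc : ConvexFun φ) {x q : E}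
    (h : IsProx φ x q) {z : E} (hz : φ z ≠ ⊤) :
    (φ q).toReal + inner ℝ (x - q) (z - q) ≤ (φ z).toReal := by
  have hq := h.ne_top hφ
  have key : ∀ t : ℝ, 0 < t → t < 1 →
      (φ q).toReal + inner ℝ (x - q) (z - q) ≤ (φ z).toReal + t * (‖z - q‖ ^ 2 / 2) := by
    intro t ht0 ht1
    obtain ⟨h1, h2⟩ := hc.ne_top_and_toReal_le hφ hz hq ht0 (sub_pos.2 ht1) (by ring)
    have h3 := h (t • z + (1 - t) • q)
    simp only at h3
    rw [← hφ.coe_toReal h1, ← hφ.coe_toReal hq] at h3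
    have h4 : (φ q).toReal + ‖x - q‖ ^ 2 / 2 ≤ (φ (t • z + (1 - t) • q)).toReal
        + ‖x - (t • z + (1 - t) • q)‖ ^ 2 / 2 := by exact_mod_cast h3
    have h5 : x - (t • z + (1 - t) • q) = (x - q) - t • (z - q) := by module
    have h6 : ‖x - (t • z + (1 - t) • q)‖ ^ 2
        = ‖x - q‖ ^ 2 - 2 * (t * inner ℝ (x - q) (z - q)) + t ^ 2 * ‖z - q‖ ^ 2 := by
      rw [h5, norm_sub_sq_real, inner_smul_right, norm_smul, mul_pow, Real.norm_of_nonneg ht0.le]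
    rw [h6] at h4
    have h7 : 0 ≤ t * ((φ z).toReal + t * (‖z - q‖ ^ 2 / 2)
        - ((φ q).toReal + inner ℝ (x - q) (z - q))) := by nlinarith
    exact sub_nonneg.1 (nonneg_of_mul_nonneg_right h7 ht0)
  have hlim : Tendsto (fun t : ℝ => (φ z).toReal + t * (‖z - q‖ ^ 2 / 2)) (𝓝[>] 0)
      (𝓝 ((φ z).toReal)) := by
    have : Tendsto (fun t : ℝ => (φ z).toReal + t * (‖z - q‖ ^ 2 / 2)) (𝓝 0)
        (𝓝 ((φ z).toReal + 0 * (‖z - q‖ ^ 2 / 2))) := by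
      apply Continuous.tendsto; fun_prop
    rw [zero_mul, add_zero] at this
    exact this.mono_left nhdsWithin_le_nhds
  refine ge_of_tendsto hlim ?_
  filter_upwards [Ioo_mem_nhdsGT (zero_lt_one (α := ℝ))] with t ht
  exact key t ht.1 ht.2

/-- The proximal point of `c • φ`, with the inequality divided by `c`. -/
theorem prox_const_mul_spec [CompleteSpace E] {φ : E → EReal} (hφ : Proper φ) (hc : ConvexFun φ)
    (hl : LowerSemicontinuous φ) {c : ℝ} (hc0 : 0 < c) (x : E) :
    φ (prox (fun y => (c : EReal) * φ y) x) ≠ ⊤ ∧ ∀ z, φ z ≠ ⊤ →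
      (φ (prox (fun y => (c : EReal) * φ y) x)).toReal
        + c⁻¹ * inner ℝ (x - prox (fun y => (c : EReal) * φ y) x)
            (z - prox (fun y => (c : EReal) * φ y) x) ≤ (φ z).toReal := by
  have h := isProx_prox (hφ.const_mul hc0) (hc.const_mul hφ hc0) (hl.ereal_const_mul hc0) x
  set q := prox (fun y => (c : EReal) * φ y) x
  have hq := (hφ.const_mul_ne_top_iff hc0).1 (h.ne_top (hφ.const_mul hc0))
  refine ⟨hq, fun z hz => ?_⟩
  have h1 := h.inner_le (hφ.const_mul hc0) (hc.const_mul hφ hc0)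
    ((hφ.const_mul_ne_top_iff hc0).2 hz)
  simp only [EReal.toReal_mul, EReal.toReal_coe] at h1
  have h2 : c * (c⁻¹ * inner ℝ (x - q) (z - q)) = inner ℝ (x - q) (z - q) := by
    field_simp
  refine le_of_mul_le_mul_left ?_ hc0
  rw [mul_add, h2]
  exact h1

end Prox

/-! ### Gradients, block updates and delayed points -/

section Gradient

/-- The gradient inequality for a differentiable convex function. -/
theorem add_inner_gradient_le {H : Type*} [NormedAddCommGroup H] [InnerProductSpace ℝ H]
    [CompleteSpace H] {f : H → ℝ} (hf : ConvexOn ℝ Set.univ f) (hfd : Differentiable ℝ f)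
    (x y : H) : f x + inner ℝ (∇ f x) (y - x) ≤ f y := by
  have hline : ConvexOn ℝ Set.univ fun t : ℝ => f (AffineMap.lineMap x y t) :=
    hf.comp_affineMap (AffineMap.lineMap (k := ℝ) x y)
  have hder : HasDerivAt (fun t : ℝ => f (AffineMap.lineMap x y t)) (inner ℝ (∇ f x) (y - x)) 0 := by
    have h1 : HasFDerivAt f (fderiv ℝ f x) (AffineMap.lineMap x y (0 : ℝ)) := by
      simpa using (hfd x).hasFDerivAt
    have h2 := h1.comp_hasDerivAt (0 : ℝ) (AffineMap.hasDerivAt_lineMap (a := x) (b := y))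
    rw [inner_gradient_left]
    exact h2
  have h := hline.le_slope_of_hasDerivAt (Set.mem_univ 0) (Set.mem_univ 1) zero_lt_one hder
  simp only [slope_def_field, AffineMap.lineMap_apply_one, AffineMap.lineMap_apply_zero] at h
  linarith

variable {m : ℕ} {E : Fin m → Type*}

@[simp]
theorem setBlock_same (x : PiLp 2 E) (i : Fin m) (v : E i) : setBlock x i v i = v := by
  simp [setBlock]

theorem setBlock_of_ne (x : PiLp 2 E) {i j : Fin m} (h : j ≠ i) (v : E i) :
    setBlock x i v j = x j := by
  simp [setBlock, h]

@[simp]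
theorem setBlock_self (x : PiLp 2 E) (i : Fin m) : setBlock x i (x i) = x := by
  ext j; by_cases h : j = i
  · subst h; simp
  · rw [setBlock_of_ne x h]

variable [∀ i, NormedAddCommGroup (E i)]

theorem setBlock_eq_add_single (x : PiLp 2 E) (i : Fin m) (v : E i) :
    setBlock x i v = x + PiLp.single 2 i (v - x i) := by
  ext j; by_cases h : j = i
  · subst h; simp
  · rw [setBlock_of_ne x h]; simp [h]

theorem norm_setBlock_sub (x : PiLp 2 E) (i : Fin m) (v : E i) :
    ‖setBlock x i v - x‖ = ‖v - x i‖ := by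
  rw [setBlock_eq_add_single, add_sub_cancel_left, PiLp.norm_single]

variable [∀ i, InnerProductSpace ℝ (E i)]

theorem inner_single_right (w : PiLp 2 E) (i : Fin m) (u : E i) :
    inner ℝ w (PiLp.single 2 i u) = inner ℝ (w i) u := by
  rw [PiLp.inner_apply, Finset.sum_eq_single i]
  · simp
  · intro j _ h; simp [h]
  · simp

theorem inner_setBlock_sub (w x : PiLp 2 E) (i : Fin m) (v : E i) :
    inner ℝ w (setBlock x i v - x) = inner ℝ (w i) (v - x i) := by
  rw [setBlock_eq_add_single, add_sub_cancel_left, inner_single_right]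

variable [∀ i, CompleteSpace (E i)]

/-- The descent lemma along one block. -/
theorem setBlock_descent {f : PiLp 2 E → ℝ} (hfd : Differentiable ℝ f) (x : PiLp 2 E) (i : Fin m)
    {K : ℝ≥0} (hK : LipschitzWith K fun v : E i => (∇ f (setBlock x i v)) i) (v : E i) :
    f (setBlock x i v) ≤ f x + inner ℝ ((∇ f x) i) (v - x i) + K / 2 * ‖v - x i‖ ^ 2 := by
  set u := v - x i with hu
  have hline : ∀ t : ℝ, setBlock x i (x i + t • u) = x + t • PiLp.single 2 i u := by
    intro t
    rw [setBlock_eq_add_single, add_sub_cancel_left]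
    congr 1
    ext j; by_cases h : j = i
    · subst h; simp
    · simp [h]
  have hder : ∀ t : ℝ, HasDerivAt (fun t : ℝ => f (setBlock x i (x i + t • u))
      - t * inner ℝ ((∇ f x) i) u - K / 2 * ‖u‖ ^ 2 * t ^ 2)
      (inner ℝ ((∇ f (setBlock x i (x i + t • u))) i) u - inner ℝ ((∇ f x) i) u
        - K * ‖u‖ ^ 2 * t) t := by
    intro t
    have h1 : HasDerivAt (fun t : ℝ => x + t • PiLp.single 2 i u) (PiLp.single 2 i u) t := by
      simpa using ((hasDerivAt_id t).smul_const (PiLp.single 2 i u)).const_add x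
    have h2 := (hfd (x + t • PiLp.single 2 i u)).hasFDerivAt.comp_hasDerivAt t h1
    have h3 : HasDerivAt (fun t : ℝ => f (setBlock x i (x i + t • u)))
        (inner ℝ ((∇ f (setBlock x i (x i + t • u))) i) u) t := by
      simp only [hline]
      rw [← inner_single_right, inner_gradient_left]
      exact h2
    have h4 := (h3.sub ((hasDerivAt_id t).mul_const (inner ℝ ((∇ f x) i) u))).sub
      ((hasDerivAt_pow 2 t).const_mul (K / 2 * ‖u‖ ^ 2))
    refine h4.congr_deriv ?_
    simp; ring
  have hanti := antitoneOn_of_hasDerivWithinAt_nonpos (convex_Ici (0 : ℝ))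
    (fun t _ => (hder t).continuousAt.continuousWithinAt)
    (fun t _ => (hder t).hasDerivWithinAt) (by
      intro t ht
      rw [interior_Ici] at ht
      have ht0 : 0 < t := ht
      have h1 := hK.dist_le_mul (x i + t • u) (x i)
      simp only [setBlock_self, dist_eq_norm, add_sub_cancel_left, norm_smul,
        Real.norm_of_nonneg ht0.le] at h1
      have h2 := real_inner_le_norm ((∇ f (setBlock x i (x i + t • u))) i - (∇ f x) i) u
      rw [inner_sub_left] at h2
      have h3 : ‖(∇ f (setBlock x i (x i + t • u))) i - (∇ f x) i‖ * ‖u‖ ≤ K * (t * ‖u‖) * ‖u‖ := by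
        gcongr
      nlinarith)
  have h := hanti (Set.self_mem_Ici) (Set.mem_Ici.2 zero_le_one) zero_le_one
  simp only [zero_smul, add_zero, setBlock_self, one_smul] at h
  have hv : x i + u = v := by simp [hu]
  rw [hv] at h
  linarith

/-- The block Lipschitz continuity of the gradient integrated along a path that changes one block
at a time: it bounds the variation of the gradient and the Bregman distance by the length. -/
theorem gradient_path_bound {f : PiLp 2 E → ℝ} (hfd : Differentiable ℝ f) {K : ℝ≥0}
    (hK : ∀ (x : PiLp 2 E) (i : Fin m), LipschitzWith K fun v : E i => ∇ f (setBlock x i v))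
    (y : ℕ → PiLp 2 E) (b : ℕ → Fin m) (s : ℕ → ℝ)
    (hy : ∀ l, y (l + 1) = setBlock (y l) (b l) (y (l + 1) (b l)))
    (hs : ∀ l, ‖y (l + 1) (b l) - y l (b l)‖ ≤ s l) (n : ℕ) :
    ‖∇ f (y n) - ∇ f (y 0)‖ ≤ K * ∑ h ∈ Finset.range n, s h ∧
      f (y n) - f (y 0) - inner ℝ (∇ f (y 0)) (y n - y 0)
        ≤ K / 2 * (∑ h ∈ Finset.range n, s h) ^ 2 := by
  have hs0 : ∀ l, 0 ≤ s l := fun l => (norm_nonneg _).trans (hs l)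
  induction n with
  | zero => simp
  | succ n ih =>
    obtain ⟨ih1, ih2⟩ := ih
    have hS : 0 ≤ ∑ h ∈ Finset.range n, s h := Finset.sum_nonneg fun l _ => hs0 l
    rw [Finset.sum_range_succ]
    set S := ∑ h ∈ Finset.range n, s h
    have hg : ‖∇ f (y (n + 1)) - ∇ f (y n)‖ ≤ K * s n := by
      have h := (hK (y n) (b n)).dist_le_mul (y (n + 1) (b n)) (y n (b n))
      simp only [setBlock_self, ← hy n, dist_eq_norm] at h
      exact h.trans (by gcongr; exact hs n)
    constructor
    · calc ‖∇ f (y (n + 1)) - ∇ f (y 0)‖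
          ≤ ‖∇ f (y (n + 1)) - ∇ f (y n)‖ + ‖∇ f (y n) - ∇ f (y 0)‖ := norm_sub_le_norm_sub_add_norm_sub ..
        _ ≤ K * (S + s n) := by linarith
    · have hblock : LipschitzWith K fun v : E (b n) => (∇ f (setBlock (y n) (b n) v)) (b n) := by
        refine LipschitzWith.of_dist_le_mul fun v w => ?_
        refine le_trans ?_ ((hK (y n) (b n)).dist_le_mul v w)
        rw [dist_eq_norm, dist_eq_norm, ← PiLp.sub_apply]
        exact PiLp.norm_apply_le _ _
      have hd := setBlock_descent hfd (y n) (b n) hblock (y (n + 1) (b n))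
      rw [← hy n, ← inner_setBlock_sub (∇ f (y n)) (y n) (b n) (y (n + 1) (b n)), ← hy n] at hd
      have hn : ‖y (n + 1) - y n‖ ≤ s n := by
        have := norm_setBlock_sub (y n) (b n) (y (n + 1) (b n))
        rw [← hy n] at this
        exact this.le.trans (hs n)
      have hc := real_inner_le_norm (∇ f (y n) - ∇ f (y 0)) (y (n + 1) - y n)
      have hc' : ‖∇ f (y n) - ∇ f (y 0)‖ * ‖y (n + 1) - y n‖ ≤ K * S * s n := by gcongr
      have hsq : K / 2 * ‖y (n + 1) (b n) - y n (b n)‖ ^ 2 ≤ K / 2 * s n ^ 2 := by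
        gcongr; exact hs n
      rw [inner_sub_left] at hc
      have hsplit : y (n + 1) - y 0 = (y (n + 1) - y n) + (y n - y 0) := by abel
      rw [hsplit, inner_add_right]
      nlinarith

/-- The blocks that are outdated in a delayed point are refreshed one iteration at a time, so the
path from the delayed point to the current one has one-block steps no longer than the steps of the
sequence. -/
theorem delayed_bound {f : PiLp 2 E → ℝ} (hfd : Differentiable ℝ f) {K : ℝ≥0}
    (hK : ∀ (x : PiLp 2 E) (i : Fin m), LipschitzWith K fun v : E i => ∇ f (setBlock x i v))
    (x : ℕ → PiLp 2 E) (b : ℕ → Fin m)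
    (hx : ∀ l, x (l + 1) = setBlock (x l) (b l) (x (l + 1) (b l)))
    {k τ : ℕ} {d : Fin m → ℕ} (hd : ∀ j, d j ≤ min k τ) :
    ‖∇ f (x k) - ∇ f (delayed x k d)‖
        ≤ K * ∑ h ∈ Finset.Ico (k - τ) k, ‖x (h + 1) - x h‖ ∧
      f (x k) - f (delayed x k d) - inner ℝ (∇ f (delayed x k d)) (x k - delayed x k d)
        ≤ K / 2 * (∑ h ∈ Finset.Ico (k - τ) k, ‖x (h + 1) - x h‖) ^ 2 := by
  set y : ℕ → PiLp 2 E := fun l => WithLp.toLp 2 fun j => x (max (k - τ + l) (k - d j)) j with hydef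
  have happ : ∀ l j, y l j = x (max (k - τ + l) (k - d j)) j := fun l j => rfl
  have hstep : ∀ l j, j ≠ b (k - τ + l) → y (l + 1) j = y l j := by
    intro l j hj
    rw [happ (l + 1), happ l]
    rcases le_or_gt (k - d j) (k - τ + l) with h | h
    · rw [max_eq_left (by omega), max_eq_left h, ← add_assoc, hx, setBlock_of_ne _ hj]
    · rw [max_eq_right (by omega), max_eq_right h.le]
  have hy : ∀ l, y (l + 1) = setBlock (y l) (b (k - τ + l)) (y (l + 1) (b (k - τ + l))) := by
    intro l
    ext j
    by_cases hj : j = b (k - τ + l)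
    · subst hj; rw [setBlock_same]
    · rw [setBlock_of_ne _ hj, hstep l j hj]
  have hs : ∀ l, ‖y (l + 1) (b (k - τ + l)) - y l (b (k - τ + l))‖
      ≤ ‖x (k - τ + l + 1) - x (k - τ + l)‖ := by
    intro l
    rw [happ (l + 1), happ l]
    set j := b (k - τ + l)
    rcases le_or_gt (k - d j) (k - τ + l) with h | h
    · rw [max_eq_left (by omega), max_eq_left h, ← add_assoc, ← PiLp.sub_apply]
      exact PiLp.norm_apply_le _ _
    · rw [max_eq_right (by omega), max_eq_right h.le, sub_self, norm_zero]
      exact norm_nonneg _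
  have h0 : y 0 = delayed x k d := by
    ext j
    have := hd j
    change x (max (k - τ + 0) (k - d j)) j = x (k - d j) j
    rw [max_eq_right (by omega)]
  have hk : y (k - (k - τ)) = x k := by
    ext j
    rw [happ, max_eq_left (by omega), show k - τ + (k - (k - τ)) = k by omega]
  have h := gradient_path_bound hfd hK y (fun l => b (k - τ + l)) _ hy hs (k - (k - τ))
  rw [Finset.sum_Ico_eq_sum_range, ← h0, ← hk]
  exact h

end Gradient

/-! ### The expected one-step inequalities -/

section OneStep

/-- A weighted Cauchy–Schwarz and Young estimate of the error due to the delays. -/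
theorem sum_mul_mul_le_of_sq_le {ι : Type*} [Fintype ι] {p a n : ι → ℝ} {pM c K σ S τ : ℝ}
    (hp : ∀ j, 0 ≤ p j) (hpM : ∀ j, p j ≤ pM) (hc : 0 ≤ c) (hcM : pM ≤ c ^ 2) (hK : 0 ≤ K)
    (hS : 0 ≤ S) (hτ : 0 ≤ τ) (ha : ∑ j, a j ^ 2 ≤ (K * σ) ^ 2) (hσ : σ ^ 2 ≤ τ * S) :
    ∑ j, p j * (a j * n j) ≤ c * K / 2 * (S + τ * ∑ j, p j * n j ^ 2) := by
  set D := ∑ j, p j * n j ^ 2 with hD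
  have hD0 : 0 ≤ D := Finset.sum_nonneg fun j _ => mul_nonneg (hp j) (sq_nonneg _)
  have h1 : (∑ j, p j * (a j * n j)) ^ 2 ≤ (∑ j, p j * a j ^ 2) * D := by
    refine Finset.sum_sq_le_sum_mul_sum_of_sq_le_mul _ (fun j _ => mul_nonneg (hp j) (sq_nonneg _))
      (fun j _ => mul_nonneg (hp j) (sq_nonneg _)) (fun j _ => le_of_eq (by ring))
  have h2 : ∑ j, p j * a j ^ 2 ≤ c ^ 2 * (K ^ 2 * (τ * S)) := by
    calc ∑ j, p j * a j ^ 2 ≤ ∑ j, c ^ 2 * a j ^ 2 :=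
          Finset.sum_le_sum fun j _ => by gcongr; exact (hpM j).trans hcM
      _ = c ^ 2 * ∑ j, a j ^ 2 := by rw [Finset.mul_sum]
      _ ≤ c ^ 2 * (K ^ 2 * (τ * S)) := by
          gcongr
          calc _ ≤ (K * σ) ^ 2 := ha
            _ = K ^ 2 * σ ^ 2 := by ring
            _ ≤ _ := by gcongr
  refine le_of_sq_le_sq ?_ (by positivity)
  calc (∑ j, p j * (a j * n j)) ^ 2 ≤ c ^ 2 * (K ^ 2 * (τ * S)) * D := h1.trans (by gcongr)
    _ ≤ c ^ 2 * K ^ 2 * ((S + τ * D) ^ 2 / 4) := by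
        rw [show c ^ 2 * (K ^ 2 * (τ * S)) * D = c ^ 2 * K ^ 2 * (S * (τ * D)) by ring]
        gcongr
        nlinarith [sq_nonneg (S - τ * D)]
    _ = _ := by ring

set_option maxHeartbeats 1000000 in
/-- The arithmetic that combines the expected decrease of the objective with the expected decrease
of the distance to a point `z`. Here `n j` is the length of the step along block `j`, `q j` the
decrease that the proximal inequality guarantees, `S` the sum of the last `τ` squared step
lengths and `Q` a weighted version of that sum, which telescopes. -/
theorem lyapunov_arithmetic {ι : Type*} [Fintype ι] {p γ L n q F' W' : ι → ℝ}
    {pm c K τ δ F Fz W S Q : ℝ} (hp1 : ∑ j, p j = 1) (hpm0 : 0 < pm)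
    (hpm : ∀ j, pm ≤ p j) (hc0 : 0 < c) (hc : √pm ≤ c) (hK : 0 ≤ K) (hτ : 0 ≤ τ)
    (hL : ∀ j, 0 ≤ L j)
    (hγ : ∀ j, 0 < γ j) (hδ2 : δ < 2) (hδ : ∀ j, L j * γ j + 2 * γ j * τ * K * c ≤ δ)
    (hq : ∀ j, (γ j)⁻¹ * n j ^ 2 ≤ q j)
    (hdesc : ∑ j, p j * F' j ≤ F - ∑ j, p j * q j + ∑ j, p j * (L j / 2 * n j ^ 2)
      + c * K / 2 * (S + τ * ∑ j, p j * n j ^ 2))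
    (hdist : ∑ j, p j * W' j ≤ W - 1 / 2 * ∑ j, (γ j)⁻¹ * n j ^ 2 + (Fz - F) + K * τ / 2 * S
      + ∑ j, q j)
    (hQ : Q ≤ τ * S) :
    ∑ j, p j * (F' j + K * c / 2 * (Q - S + τ * n j ^ 2)) ≤ F + K * c / 2 * Q ∧
    ∑ j, p j * (W' j
        + (max 1 (2 - δ)⁻¹ / pm - 1 + τ * (1 / (√pm * (2 - δ))) * (1 + c))
          * (F' j + K * c / 2 * (Q - S + τ * n j ^ 2) - Fz)
        + (1 + c) * (K * τ / 2) * (Q - S + τ * n j ^ 2))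
      ≤ W + (max 1 (2 - δ)⁻¹ / pm - 1 + τ * (1 / (√pm * (2 - δ))) * (1 + c))
          * (F + K * c / 2 * Q - Fz)
        + (1 + c) * (K * τ / 2) * Q
        - (∑ j, p j * (F' j + K * c / 2 * (Q - S + τ * n j ^ 2)) - Fz) := by
  set C := max 1 (2 - δ)⁻¹ / pm - 1 + τ * (1 / (√pm * (2 - δ))) * (1 + c) with hCdef
  have hδ' : 0 < 2 - δ := by linarith
  have hp0 : ∀ j, 0 ≤ p j := fun j => hpm0.le.trans (hpm j)
  set D := ∑ j, p j * n j ^ 2 with hD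
  set N := ∑ j, (γ j)⁻¹ * n j ^ 2 with hN
  set t : ι → ℝ := fun j => q j - (L j / 2 + K * c * τ) * n j ^ 2 with ht
  -- the expectation of an affine function of the next state
  have hE : ∀ a b : ℝ, ∑ j, p j * (a + b * n j ^ 2) = a + b * D := by
    intro a b
    calc ∑ j, p j * (a + b * n j ^ 2) = ∑ j, (p j * a + b * (p j * n j ^ 2)) :=
          Finset.sum_congr rfl fun j _ => by ring
      _ = a + b * D := by
          rw [Finset.sum_add_distrib, ← Finset.sum_mul, hp1, one_mul, ← Finset.mul_sum]
  have hEF : ∑ j, p j * (F' j + K * c / 2 * (Q - S + τ * n j ^ 2))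
      = ∑ j, p j * F' j + K * c / 2 * (Q - S + τ * D) := by
    have := hE (K * c / 2 * (Q - S)) (K * c / 2 * τ)
    calc _ = ∑ j, (p j * F' j + p j * (K * c / 2 * (Q - S) + K * c / 2 * τ * n j ^ 2)) :=
          Finset.sum_congr rfl fun j _ => by ring
      _ = _ := by rw [Finset.sum_add_distrib, this]; ring
  set EΨ := ∑ j, p j * (F' j + K * c / 2 * (Q - S + τ * n j ^ 2)) with hEΨ
  have hPT : ∑ j, p j * t j
      = ∑ j, p j * q j - ∑ j, p j * (L j / 2 * n j ^ 2) - K * c * τ * D := by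
    rw [hD, Finset.mul_sum, ← Finset.sum_sub_distrib, ← Finset.sum_sub_distrib]
    exact Finset.sum_congr rfl fun j _ => by simp only [ht]; ring
  set PT := ∑ j, p j * t j with hPTdef
  have hG : PT ≤ F + K * c / 2 * Q - EΨ := by
    rw [hEF, hPT]; linarith
  -- both parts of the step-size condition
  have hstep : ∀ j, (L j / 2 + K * c * τ) * n j ^ 2 ≤ δ / 2 * ((γ j)⁻¹ * n j ^ 2) := by
    intro j
    rw [← mul_assoc]
    gcongr
    rw [← div_eq_mul_inv, le_div_iff₀ (hγ j)]
    nlinarith [hδ j]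
  have hKc : ∀ j, K * c * τ * n j ^ 2 ≤ (γ j)⁻¹ * n j ^ 2 := by
    intro j
    have h1 := hstep j
    have h2 : 0 ≤ (γ j)⁻¹ * n j ^ 2 := by have := hγ j; positivity
    have h3 : 0 ≤ L j / 2 * n j ^ 2 := by have := hL j; positivity
    nlinarith
  have htN : ∀ j, (2 - δ) / 2 * ((γ j)⁻¹ * n j ^ 2) ≤ t j := by
    intro j
    have := hstep j; have := hq j
    simp only [ht]; linarith
  have ht0 : ∀ j, 0 ≤ t j := fun j =>
    le_trans (by have := hγ j; positivity) (htN j)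
  have hPT0 : 0 ≤ PT := Finset.sum_nonneg fun j _ => mul_nonneg (hp0 j) (ht0 j)
  have hG0 : 0 ≤ F + K * c / 2 * Q - EΨ := hPT0.trans hG
  refine ⟨by linarith, ?_⟩
  set G := F + K * c / 2 * Q - EΨ with hGdef
  have hT : pm * ∑ j, t j ≤ G := by
    refine le_trans ?_ hG
    rw [Finset.mul_sum]
    exact Finset.sum_le_sum fun j _ => mul_le_mul_of_nonneg_right (hpm j) (ht0 j)
  have hTN : (2 - δ) / 2 * N ≤ ∑ j, t j := by
    rw [hN, Finset.mul_sum]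
    exact Finset.sum_le_sum fun j _ => htN j
  have hSQ : ∑ j, q j ≤ ∑ j, t j + δ / 2 * N := by
    rw [hN, Finset.mul_sum, ← Finset.sum_add_distrib]
    refine Finset.sum_le_sum fun j _ => ?_
    have := hstep j
    simp only [ht]; linarith
  set T := ∑ j, t j with hTdef
  have hT0 : 0 ≤ T := Finset.sum_nonneg fun j _ => ht0 j
  have hN0 : 0 ≤ N := Finset.sum_nonneg fun j _ => by have := hγ j; positivity
  have hmain : ∑ j, q j - 1 / 2 * N ≤ max 1 (2 - δ)⁻¹ / pm * G := by
    have h1 : ∑ j, q j - 1 / 2 * N ≤ max 1 (2 - δ)⁻¹ * T := by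
      rcases le_total δ 1 with h | h
      · calc ∑ j, q j - 1 / 2 * N ≤ 1 * T := by nlinarith
          _ ≤ _ := by gcongr; exact le_max_left _ _
      · have h2 : ∑ j, q j - 1 / 2 * N ≤ (2 - δ)⁻¹ * T := by
          rw [inv_mul_eq_div, le_div_iff₀ hδ']
          nlinarith
        exact h2.trans (by gcongr; exact le_max_right _ _)
    refine h1.trans ?_
    rw [div_mul_eq_mul_div, le_div_iff₀ hpm0, mul_assoc]
    gcongr
    linarith
  have hDG : K * c * τ * D ≤ 2 / (2 - δ) * G := by
    have h1 : (2 - δ) / 2 * (K * c * τ * D) ≤ PT := by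
      rw [hD, Finset.mul_sum, Finset.mul_sum]
      refine Finset.sum_le_sum fun j _ => ?_
      have h2 : (2 - δ) / 2 * (K * c * τ * n j ^ 2) ≤ t j :=
        le_trans (mul_le_mul_of_nonneg_left (hKc j) (by linarith)) (htN j)
      have := mul_le_mul_of_nonneg_left h2 (hp0 j)
      linarith
    rw [div_mul_eq_mul_div, le_div_iff₀ hδ']
    linarith
  have hsp : 0 < √pm := Real.sqrt_pos.2 hpm0
  have hβ : K * τ / 2 * (τ * D) ≤ τ * (1 / (√pm * (2 - δ))) * G := by
    have h1 : K * τ / 2 * (τ * D) = τ / (2 * c) * (K * c * τ * D) := by field_simp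
    rw [h1]
    calc τ / (2 * c) * (K * c * τ * D) ≤ τ / (2 * c) * (2 / (2 - δ) * G) := by gcongr
      _ = τ * (1 / (c * (2 - δ))) * G := by field_simp
      _ ≤ _ := by gcongr
  have hLHS : ∑ j, p j * (W' j + C * (F' j + K * c / 2 * (Q - S + τ * n j ^ 2) - Fz)
        + (1 + c) * (K * τ / 2) * (Q - S + τ * n j ^ 2))
      = ∑ j, p j * W' j + C * (EΨ - Fz) + (1 + c) * (K * τ / 2) * (Q - S + τ * D) := by
    have h1 := hE (-(C * Fz) + (1 + c) * (K * τ / 2) * (Q - S)) ((1 + c) * (K * τ / 2) * τ)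
    calc _ = ∑ j, (p j * W' j + C * (p j * (F' j + K * c / 2 * (Q - S + τ * n j ^ 2)))
          + p j * (-(C * Fz) + (1 + c) * (K * τ / 2) * (Q - S)
            + (1 + c) * (K * τ / 2) * τ * n j ^ 2)) :=
          Finset.sum_congr rfl fun j _ => by ring
      _ = _ := by
          rw [Finset.sum_add_distrib, Finset.sum_add_distrib, h1, ← Finset.mul_sum, ← hEΨ]; ring
  rw [hLHS]
  have hfin1 : (1 + c) * (K * τ / 2 * (τ * D)) ≤ (1 + c) * (τ * (1 / (√pm * (2 - δ))) * G) := by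
    gcongr
  have hfin2 : K * c / 2 * Q ≤ K * c / 2 * (τ * S) := by gcongr
  have hCG : C * G = max 1 (2 - δ)⁻¹ / pm * G - G
      + (1 + c) * (τ * (1 / (√pm * (2 - δ))) * G) := by rw [hCdef]; ring
  have hΨ : C * (F + K * c / 2 * Q - Fz) = C * (EΨ - Fz) + C * G := by rw [hGdef]; ring
  rw [hΨ, hCG]
  have hGe : EΨ = F + K * c / 2 * Q - G := by rw [hGdef]; ring
  clear_value C EΨ G D N T PT
  generalize max 1 (2 - δ)⁻¹ / pm * G = X at *
  generalize τ * (1 / (√pm * (2 - δ))) * G = Y at *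
  generalize C * (EΨ - Fz) = Z at *
  linarith

end OneStep

/-! ### The objective on its domain -/

section Objective

variable {m : ℕ} {E : Fin m → Type*}

/-- The objective as a real number; it is meaningful only where all `g j (x j)` are finite. -/
noncomputable def realObjective (f : PiLp 2 E → ℝ) (g : (i : Fin m) → E i → EReal)
    (x : PiLp 2 E) : ℝ :=
  f x + ∑ j, (g j (x j)).toReal

theorem sum_setBlock (φ : (j : Fin m) → E j → ℝ) (x : PiLp 2 E) (i : Fin m) (v : E i) :
    ∑ j, φ j (setBlock x i v j) = ∑ j, φ j (x j) + (φ i v - φ i (x i)) := by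
  rw [← Finset.add_sum_erase _ _ (Finset.mem_univ i),
    ← Finset.add_sum_erase (a := i) _ (fun j => φ j (x j)) (Finset.mem_univ i), setBlock_same,
    Finset.sum_congr rfl fun j hj => by rw [setBlock_of_ne x (Finset.ne_of_mem_erase hj)]]
  ring

theorem ereal_sum_ne_bot {ι : Type*} (s : Finset ι) {a : ι → EReal} (ha : ∀ j ∈ s, a j ≠ ⊥) :
    ∑ j ∈ s, a j ≠ ⊥ := by
  classical
  induction s using Finset.induction_on with
  | empty => simp
  | insert j s hj ih =>
    rw [Finset.sum_insert hj, Ne, EReal.add_eq_bot_iff, not_or]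
    exact ⟨ha j (Finset.mem_insert_self j s), ih fun l hl => ha l (Finset.mem_insert_of_mem hl)⟩

variable {f : PiLp 2 E → ℝ} {g : (i : Fin m) → E i → EReal}

theorem objective_eq_coe (hg : ∀ i, Proper (g i)) {x : PiLp 2 E} (hx : ∀ j, g j (x j) ≠ ⊤) :
    objective f g x = realObjective f g x := by
  have h : ∀ s : Finset (Fin m),
      ∑ j ∈ s, g j (x j) = ((∑ j ∈ s, (g j (x j)).toReal : ℝ) : EReal) := by
    intro s
    classical
    induction s using Finset.induction_on with
    | empty => simp
    | insert j s hj ih =>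
      rw [Finset.sum_insert hj, Finset.sum_insert hj, EReal.coe_add, ih, (hg j).coe_toReal (hx j)]
  rw [objective, realObjective, EReal.coe_add, h]

theorem objective_ne_top_iff (hg : ∀ i, Proper (g i)) {x : PiLp 2 E} :
    objective f g x ≠ ⊤ ↔ ∀ j, g j (x j) ≠ ⊤ := by
  classical
  constructor
  · intro h j hj
    apply h
    rw [objective, ← Finset.add_sum_erase _ _ (Finset.mem_univ j), hj, EReal.top_add_of_ne_bot,
      EReal.coe_add_top]
    exact ereal_sum_ne_bot _ fun l _ => (hg l).1 _
  · intro h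
    rw [objective_eq_coe hg h]
    exact EReal.coe_ne_top _

theorem exists_forall_ne_top (hg : ∀ i, Proper (g i)) : ∃ x : PiLp 2 E, ∀ j, g j (x j) ≠ ⊤ := by
  choose y hy using fun i => (hg i).2
  exact ⟨WithLp.toLp 2 y, hy⟩

theorem argmin_ne_top (hg : ∀ i, Proper (g i)) {z : PiLp 2 E} (hz : z ∈ argmin (objective f g)) :
    ∀ j, g j (z j) ≠ ⊤ := by
  obtain ⟨y, hy⟩ := exists_forall_ne_top hg
  exact (objective_ne_top_iff (f := f) hg).1
    (ne_top_of_le_ne_top ((objective_ne_top_iff hg).2 hy) (hz y))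

theorem minValue_eq (hg : ∀ i, Proper (g i)) {z : PiLp 2 E} (hz : z ∈ argmin (objective f g)) :
    minValue (objective f g) = realObjective f g z := by
  have h : ⨅ x, objective f g x = objective f g z := le_antisymm (iInf_le _ z) (le_iInf hz)
  rw [minValue, h, objective_eq_coe hg (argmin_ne_top hg hz), EReal.toReal_coe]

theorem realObjective_argmin_le (hg : ∀ i, Proper (g i)) {z : PiLp 2 E}
    (hz : z ∈ argmin (objective f g)) {x : PiLp 2 E} (hx : ∀ j, g j (x j) ≠ ⊤) :
    realObjective f g z ≤ realObjective f g x := by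
  have h := hz x
  rw [objective_eq_coe hg (argmin_ne_top hg hz), objective_eq_coe hg hx] at h
  exact_mod_cast h

theorem lowerSemicontinuous_objective [∀ i, NormedAddCommGroup (E i)] (hf : Continuous f)
    (hgl : ∀ i, LowerSemicontinuous (g i)) : LowerSemicontinuous (objective f g) := by
  have hadd : ∀ a b : PiLp 2 E → EReal, LowerSemicontinuous a → LowerSemicontinuous b →
      LowerSemicontinuous fun x => a x + b x := by
    intro a b ha hb x
    by_cases h1 : a x = ⊥
    · intro t ht
      simp [h1] at ht
    by_cases h2 : b x = ⊥
    · intro t ht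
      simp [h2] at ht
    exact LowerSemicontinuousAt.add' (ha x) (hb x) (EReal.continuousAt_add (.inr h2) (.inl h1))
  refine hadd _ _ (continuous_coe_real_ereal.comp hf).lowerSemicontinuous ?_
  have : ∀ s : Finset (Fin m), LowerSemicontinuous fun x : PiLp 2 E => ∑ j ∈ s, g j (x j) := by
    intro s
    classical
    induction s using Finset.induction_on with
    | empty => simpa using lowerSemicontinuous_const
    | insert j s hj ih =>
      simp only [Finset.sum_insert hj]
      refine hadd _ _ (fun x t ht => ?_) ih
      exact ((PiLp.continuous_apply 2 E j).tendsto x).eventually (hgl j _ t ht)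
  exact this _

theorem convex_sublevel_objective [∀ i, NormedAddCommGroup (E i)]
    [∀ i, InnerProductSpace ℝ (E i)] (hf : ConvexOn ℝ Set.univ f) (hg : ∀ i, Proper (g i))
    (hgc : ∀ i, ConvexFun (g i)) (a : ℝ) : Convex ℝ {x | objective f g x ≤ a} := by
  rw [convex_iff_forall_pos]
  intro x hx y hy s t hs ht hst
  have hxd := (objective_ne_top_iff hg).1 (ne_top_of_le_ne_top (EReal.coe_ne_top a) hx)
  have hyd := (objective_ne_top_iff hg).1 (ne_top_of_le_ne_top (EReal.coe_ne_top a) hy)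
  have hc := fun j => (hgc j).ne_top_and_toReal_le (hg j) (hxd j) (hyd j) hs ht hst
  have hd : ∀ j, g j ((s • x + t • y) j) ≠ ⊤ := fun j => (hc j).1
  simp only [Set.mem_ofPred_eq] at hx hy ⊢
  rw [objective_eq_coe hg hxd] at hx
  rw [objective_eq_coe hg hyd] at hy
  rw [objective_eq_coe hg hd]
  norm_cast at hx hy ⊢
  have h1 := hf.2 (Set.mem_univ x) (Set.mem_univ y) hs.le ht.le hst
  have h2 : ∑ j, (g j ((s • x + t • y) j)).toReal
      ≤ s * ∑ j, (g j (x j)).toReal + t * ∑ j, (g j (y j)).toReal := by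
    rw [Finset.mul_sum, Finset.mul_sum, ← Finset.sum_add_distrib]
    exact Finset.sum_le_sum fun j _ => (hc j).2
  simp only [smul_eq_mul] at h1
  rw [realObjective] at hx hy ⊢
  calc _ ≤ s * a + t * a := by nlinarith
    _ = a := by rw [← add_mul, hst, one_mul]

end Objective

/-! ### One forward-backward step from a delayed gradient -/

section Step

variable {m : ℕ} {E : Fin m → Type*} [∀ i, NormedAddCommGroup (E i)]
  [∀ i, InnerProductSpace ℝ (E i)] [∀ i, CompleteSpace (E i)]

/-- The `j`-th block of the full forward-backward point, with the gradient taken at `y`. -/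
noncomputable def fbPoint (f : PiLp 2 E → ℝ) (g : (i : Fin m) → E i → EReal) (γ : Fin m → ℝ)
    (x y : PiLp 2 E) (j : Fin m) : E j :=
  prox (fun v => (γ j : EReal) * g j v) (x j - γ j • (∇ f y) j)

variable {f : PiLp 2 E → ℝ} {g : (i : Fin m) → E i → EReal} {γ : Fin m → ℝ}

theorem fbPoint_ne_top (hg : ∀ i, Proper (g i)) (hgc : ∀ i, ConvexFun (g i))
    (hgl : ∀ i, LowerSemicontinuous (g i)) (hγ : ∀ j, 0 < γ j) (x y : PiLp 2 E) (j : Fin m) :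
    g j (fbPoint f g γ x y j) ≠ ⊤ :=
  (prox_const_mul_spec (hg j) (hgc j) (hgl j) (hγ j) _).1

theorem fbPoint_spec (hg : ∀ i, Proper (g i)) (hgc : ∀ i, ConvexFun (g i))
    (hgl : ∀ i, LowerSemicontinuous (g i)) (hγ : ∀ j, 0 < γ j) (x y : PiLp 2 E) (j : Fin m)
    {v : E j} (hv : g j v ≠ ⊤) :
    (γ j)⁻¹ * inner ℝ (x j - fbPoint f g γ x y j) (v - fbPoint f g γ x y j)
      ≤ (g j v).toReal - (g j (fbPoint f g γ x y j)).toReal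
        + inner ℝ ((∇ f y) j) (v - fbPoint f g γ x y j) := by
  have h := (prox_const_mul_spec (hg j) (hgc j) (hgl j) (hγ j) (x j - γ j • (∇ f y) j)).2 v hv
  change (g j (fbPoint f g γ x y j)).toReal + (γ j)⁻¹ * inner ℝ
    (x j - γ j • (∇ f y) j - fbPoint f g γ x y j) (v - fbPoint f g γ x y j) ≤ _ at h
  rw [sub_right_comm, inner_sub_left, inner_smul_left, mul_sub] at h
  simp only [conj_trivial] at h
  rw [inv_mul_cancel_left₀ (hγ j).ne'] at h
  linarith

/-- The expected one-step inequalities: `F + (K c / 2) Q` decreases in expectation, and so does a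
Lyapunov function that adds half the squared weighted distance to `z`. -/
theorem one_step (hf : ConvexOn ℝ Set.univ f) (hfd : Differentiable ℝ f)
    (hg : ∀ i, Proper (g i)) (hgc : ∀ i, ConvexFun (g i)) (hgl : ∀ i, LowerSemicontinuous (g i))
    {L : Fin m → ℝ≥0}
    (hfL : ∀ (x : PiLp 2 E) (i : Fin m),
      LipschitzWith (L i) fun v : E i => (∇ f (setBlock x i v)) i)
    (hγ : ∀ j, 0 < γ j) {p : Fin m → ℝ} {pm pM c K τ δ : ℝ}
    (hp1 : ∑ j, p j = 1) (hpm0 : 0 < pm)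
    (hpm : ∀ j, pm ≤ p j) (hpM : ∀ j, p j ≤ pM) (hc0 : 0 < c) (hc : √pm ≤ c) (hcM : pM ≤ c ^ 2)
    (hK : 0 ≤ K) (hτ : 0 ≤ τ) (hδ2 : δ < 2)
    (hδ : ∀ j, L j * γ j + 2 * γ j * τ * K * c ≤ δ)
    {x y z : PiLp 2 E} (hx : ∀ j, g j (x j) ≠ ⊤) (hz : ∀ j, g j (z j) ≠ ⊤)
    {σ S Q : ℝ} (hS : 0 ≤ S) (hσ : σ ^ 2 ≤ τ * S) (hQ : Q ≤ τ * S)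
    (hgrad : ‖∇ f x - ∇ f y‖ ≤ K * σ)
    (hbreg : f x - f y - inner ℝ (∇ f y) (x - y) ≤ K / 2 * σ ^ 2) :
    ∑ j, p j * (realObjective f g (setBlock x j (fbPoint f g γ x y j))
        + K * c / 2 * (Q - S + τ * ‖fbPoint f g γ x y j - x j‖ ^ 2))
      ≤ realObjective f g x + K * c / 2 * Q ∧
    ∑ j, p j * (1 / 2 * ∑ l, 1 / (γ l * p l) *
            ‖setBlock x j (fbPoint f g γ x y j) l - z l‖ ^ 2
        + (max 1 (2 - δ)⁻¹ / pm - 1 + τ * (1 / (√pm * (2 - δ))) * (1 + c))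
          * (realObjective f g (setBlock x j (fbPoint f g γ x y j))
            + K * c / 2 * (Q - S + τ * ‖fbPoint f g γ x y j - x j‖ ^ 2) - realObjective f g z)
        + (1 + c) * (K * τ / 2) * (Q - S + τ * ‖fbPoint f g γ x y j - x j‖ ^ 2))
      ≤ 1 / 2 * ∑ l, 1 / (γ l * p l) * ‖x l - z l‖ ^ 2
        + (max 1 (2 - δ)⁻¹ / pm - 1 + τ * (1 / (√pm * (2 - δ))) * (1 + c))
          * (realObjective f g x + K * c / 2 * Q - realObjective f g z)
        + (1 + c) * (K * τ / 2) * Q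
        - (∑ j, p j * (realObjective f g (setBlock x j (fbPoint f g γ x y j))
            + K * c / 2 * (Q - S + τ * ‖fbPoint f g γ x y j - x j‖ ^ 2))
          - realObjective f g z) := by
  set b : (j : Fin m) → E j := fun j => fbPoint f g γ x y j with hb
  have hp0 : ∀ j, 0 < p j := fun j => hpm0.trans_le (hpm j)
  set q : Fin m → ℝ := fun j => (g j (x j)).toReal - (g j (b j)).toReal
    - inner ℝ ((∇ f y) j) (b j - x j) with hqdef
  refine lyapunov_arithmetic (q := q) (n := fun j => ‖b j - x j‖) (L := fun j => L j)
    hp1 hpm0 hpm hc0 hc hK hτ (fun j => (L j).2) hγ hδ2 hδ ?_ ?_ ?_ hQ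
  · intro j
    have h := fbPoint_spec (f := f) hg hgc hgl hγ x y j (hx j)
    rw [real_inner_self_eq_norm_sq, norm_sub_rev] at h
    have h2 : inner ℝ ((∇ f y) j) (x j - b j) = - inner ℝ ((∇ f y) j) (b j - x j) := by
      rw [← inner_neg_right, neg_sub]
    simp only [hqdef]
    change (γ j)⁻¹ * ‖b j - x j‖ ^ 2 ≤ (g j (x j)).toReal - (g j (b j)).toReal
      + inner ℝ ((∇ f y) j) (x j - b j) at h
    linarith
  · have hF : ∀ j, realObjective f g (setBlock x j (b j)) ≤ realObjective f g x - q j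
        + ‖(∇ f x - ∇ f y) j‖ * ‖b j - x j‖ + L j / 2 * ‖b j - x j‖ ^ 2 := by
      intro j
      have h1 := setBlock_descent hfd x j (hfL x j) (b j)
      have h2 := sum_setBlock (fun j v => (g j v).toReal) x j (b j)
      have h3 := real_inner_le_norm ((∇ f x - ∇ f y) j) (b j - x j)
      rw [PiLp.sub_apply, inner_sub_left, ← PiLp.sub_apply] at h3
      rw [realObjective, realObjective, h2]
      simp only [hqdef]
      linarith
    have ha : ∑ j, ‖(∇ f x - ∇ f y) j‖ ^ 2 ≤ (K * σ) ^ 2 := by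
      rw [← PiLp.norm_sq_eq_of_L2]
      gcongr
    have hcross := sum_mul_mul_le_of_sq_le (n := fun j => ‖b j - x j‖) (fun j => (hp0 j).le) hpM
      hc0.le hcM hK hS hτ ha hσ
    calc ∑ j, p j * realObjective f g (setBlock x j (b j))
        ≤ ∑ j, (p j * realObjective f g x - p j * q j
          + p j * (‖(∇ f x - ∇ f y) j‖ * ‖b j - x j‖) + p j * (L j / 2 * ‖b j - x j‖ ^ 2)) := by
          refine Finset.sum_le_sum fun j _ => ?_
          have := mul_le_mul_of_nonneg_left (hF j) (hp0 j).le
          linarith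
      _ = realObjective f g x - ∑ j, p j * q j
          + ∑ j, p j * (‖(∇ f x - ∇ f y) j‖ * ‖b j - x j‖)
          + ∑ j, p j * (L j / 2 * ‖b j - x j‖ ^ 2) := by
          rw [Finset.sum_add_distrib, Finset.sum_add_distrib, Finset.sum_sub_distrib,
            ← Finset.sum_mul, hp1, one_mul]
      _ ≤ _ := by linarith
  · have hW : ∀ j, p j * (1 / 2 * ∑ l, 1 / (γ l * p l) * ‖setBlock x j (b j) l - z l‖ ^ 2)
        ≤ p j * (1 / 2 * ∑ l, 1 / (γ l * p l) * ‖x l - z l‖ ^ 2)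
          - 1 / 2 * ((γ j)⁻¹ * ‖b j - x j‖ ^ 2) + (g j (z j)).toReal - (g j (x j)).toReal
          + inner ℝ ((∇ f y) j) ((z - x) j) + q j := by
      intro j
      rw [sum_setBlock (fun l v => 1 / (γ l * p l) * ‖v - z l‖ ^ 2) x j (b j)]
      have h1 := fbPoint_spec (f := f) hg hgc hgl hγ x y j (hz j)
      change (γ j)⁻¹ * inner ℝ (x j - b j) (z j - b j) ≤ (g j (z j)).toReal - (g j (b j)).toReal
        + inner ℝ ((∇ f y) j) (z j - b j) at h1
      have h2 : ‖b j - z j‖ ^ 2 - ‖x j - z j‖ ^ 2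
          = - ‖b j - x j‖ ^ 2 + 2 * inner ℝ (x j - b j) (z j - b j) := by
        rw [norm_sub_rev (b j) (z j), norm_sub_rev (b j) (x j),
          show x j - z j = (x j - b j) - (z j - b j) by abel, norm_sub_sq_real (x j - b j)]
        ring
      have h3 : z j - b j = (z - x) j - (b j - x j) := by rw [PiLp.sub_apply]; abel
      have h4 : inner ℝ ((∇ f y) j) (z j - b j)
          = inner ℝ ((∇ f y) j) ((z - x) j) - inner ℝ ((∇ f y) j) (b j - x j) := by
        rw [h3, inner_sub_right]
      have h5 : p j * (1 / 2 * (1 / (γ j * p j) * ‖b j - z j‖ ^ 2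
            - 1 / (γ j * p j) * ‖x j - z j‖ ^ 2))
          = 1 / 2 * (γ j)⁻¹ * (‖b j - z j‖ ^ 2 - ‖x j - z j‖ ^ 2) := by
        have := (hp0 j).ne'
        have := (hγ j).ne'
        field_simp
      rw [mul_add, mul_add, h5, h2]
      simp only [hqdef]
      linarith
    have hin : ∑ j, inner ℝ ((∇ f y) j) ((z - x) j) = inner ℝ (∇ f y) (z - x) := by
      rw [PiLp.inner_apply]
    have hconv := add_inner_gradient_le hf hfd y z
    have hsplit : inner ℝ (∇ f y) (z - x) = inner ℝ (∇ f y) (z - y) - inner ℝ (∇ f y) (x - y) := by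
      rw [← inner_sub_right]; congr 1; abel
    have hKσ : K / 2 * σ ^ 2 ≤ K * τ / 2 * S := by
      calc K / 2 * σ ^ 2 ≤ K / 2 * (τ * S) := by gcongr
        _ = _ := by ring
    refine (Finset.sum_le_sum fun j _ => hW j).trans ?_
    simp only [Finset.sum_add_distrib, Finset.sum_sub_distrib]
    rw [← Finset.sum_mul, hp1, one_mul, ← Finset.mul_sum, hin, realObjective, realObjective]
    linarith

end Step

/-! ### Functionals of independent random indices -/

section Expect

variable {m : ℕ}

/-- The conditional expectation of `Y`, given the first `k` indices, when the index with number `k`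
has law `p`, as an operator on functionals of the index sequence. -/
noncomputable def expect (p : Fin m → ℝ) (k : ℕ) (Y : (ℕ → Fin m) → ℝ) (w : ℕ → Fin m) : ℝ :=
  ∑ j, p j * Y (Function.update w k j)

theorem update_eq_of_lt {k l : ℕ} (h : l < k) (w : ℕ → Fin m) (j : Fin m) :
    Function.update w k j l = w l :=
  Function.update_of_ne h.ne _ _

theorem dependsOn_update {β : Type*} {Y : (ℕ → Fin m) → β} {k : ℕ}
    (hY : DependsOn Y (Set.Iio k)) (w : ℕ → Fin m) (j : Fin m) :
    Y (Function.update w k j) = Y w :=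
  hY fun _ hl => update_eq_of_lt hl w j

theorem dependsOn_comp_update {β : Type*} {Y : (ℕ → Fin m) → β} {k : ℕ}
    (hY : DependsOn Y (Set.Iio (k + 1))) (j : Fin m) :
    DependsOn (fun w => Y (Function.update w k j)) (Set.Iio k) := by
  intro w w' h
  refine hY fun l hl => ?_
  rcases (Nat.lt_succ_iff.1 hl).lt_or_eq with h' | h'
  · rw [update_eq_of_lt h', update_eq_of_lt h', h l h']
  · subst h'; simp

theorem dependsOn_expect {p : Fin m → ℝ} {k : ℕ} {Y : (ℕ → Fin m) → ℝ}
    (hY : DependsOn Y (Set.Iio (k + 1))) : DependsOn (expect p k Y) (Set.Iio k) := by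
  intro w w' h
  exact Finset.sum_congr rfl fun j _ => congrArg (p j * ·) (dependsOn_comp_update hY j h)

theorem expect_add_of_dependsOn {p : Fin m → ℝ} (hp1 : ∑ j, p j = 1) {k : ℕ}
    {Y Z : (ℕ → Fin m) → ℝ} (hZ : DependsOn Z (Set.Iio k)) (w : ℕ → Fin m) :
    expect p k (fun w => Y w + Z w) w = expect p k Y w + Z w := by
  simp only [expect, dependsOn_update hZ, mul_add, Finset.sum_add_distrib]
  rw [← Finset.sum_mul, hp1, one_mul]

theorem expect_indicator {p : Fin m → ℝ} {k : ℕ} {A : Set (ℕ → Fin m)}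
    (hA : DependsOn (· ∈ A) (Set.Iio k)) (Y : (ℕ → Fin m) → ℝ) (w : ℕ → Fin m) :
    expect p k (A.indicator Y) w = A.indicator (expect p k Y) w := by
  classical
  have h : ∀ j, Function.update w k j ∈ A ↔ w ∈ A := fun j =>
    iff_of_eq (dependsOn_update hA w j)
  by_cases hw : w ∈ A
  · rw [Set.indicator_of_mem hw]
    exact Finset.sum_congr rfl fun j _ => by rw [Set.indicator_of_mem ((h j).2 hw)]
  · rw [Set.indicator_of_notMem hw]
    exact Finset.sum_eq_zero fun j _ => by
      rw [Set.indicator_of_notMem (fun hc => hw ((h j).1 hc)), mul_zero]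

theorem dependsOn_indicator {k : ℕ} {A : Set (ℕ → Fin m)}
    (hA : DependsOn (· ∈ A) (Set.Iio k)) {Y : (ℕ → Fin m) → ℝ} (hY : DependsOn Y (Set.Iio k)) :
    DependsOn (A.indicator Y) (Set.Iio k) := by
  classical
  intro w w' h
  have hA' : w ∈ A ↔ w' ∈ A := iff_of_eq (hA h)
  by_cases hw : w ∈ A
  · rw [Set.indicator_of_mem hw, Set.indicator_of_mem (hA'.1 hw), hY h]
  · rw [Set.indicator_of_notMem hw, Set.indicator_of_notMem fun hc => hw (hA'.2 hc)]

variable {Ω : Type*} {i : ℕ → Ω → Fin m}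

/-- The first `k` indices. -/
def history (i : ℕ → Ω → Fin m) (k : ℕ) (ω : Ω) : Finset.range k → Fin m := fun l => i l ω

theorem exists_comp_history {β : Type*} [Nonempty β] {k : ℕ} {Y : (ℕ → Fin m) → β}
    (hY : DependsOn Y (Set.Iio k)) :
    ∃ φ : (Finset.range k → Fin m) → β,
      (∀ ω, Y (fun l => i l ω) = φ (history i k ω)) ∧ ∀ w, Y w = φ fun l => w l := by
  rw [← Finset.coe_Iio, Nat.Iio_eq_range] at hY
  obtain ⟨φ, hφ⟩ := dependsOn_iff_exists_comp.1 hY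
  exact ⟨φ, fun ω => congrFun hφ _, fun w => congrFun hφ w⟩

variable [MeasurableSpace Ω] {P : Measure Ω} [IsProbabilityMeasure P]

theorem measurable_history (hi : ∀ k, Measurable (i k)) (k : ℕ) : Measurable (history i k) :=
  measurable_pi_lambda _ fun l => hi l

/-- The filtration generated by the random indices; stage `k` knows the indices before `k`. -/
def historyFiltration (hi : ∀ k, Measurable (i k)) : Filtration ℕ ‹MeasurableSpace Ω› where
  seq k := MeasurableSpace.comap (history i k) inferInstance
  mono' k l hkl := by
    have h : history i k = (fun (w : Finset.range l → Fin m) (j : Finset.range k) =>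
        w ⟨j, Finset.range_mono hkl j.2⟩) ∘ history i l := rfl
    beta_reduce
    rw [h, ← MeasurableSpace.comap_comp]
    exact MeasurableSpace.comap_mono
      (measurable_pi_lambda _ fun j => measurable_pi_apply _).comap_le
  le' k := (measurable_history hi k).comap_le

theorem measurable_of_dependsOn (hi : ∀ k, Measurable (i k)) {k : ℕ} {Y : (ℕ → Fin m) → ℝ}
    (hY : DependsOn Y (Set.Iio k)) :
    Measurable[historyFiltration hi k] fun ω => Y fun l => i l ω := by
  obtain ⟨φ, hφ, -⟩ := exists_comp_history (i := i) hY
  simp only [hφ]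
  exact (Measurable.of_discrete (f := φ)).comp (comap_measurable (history i k))

theorem integrable_of_dependsOn (hi : ∀ k, Measurable (i k)) {k : ℕ} {Y : (ℕ → Fin m) → ℝ}
    (hY : DependsOn Y (Set.Iio k)) : Integrable (fun ω => Y fun l => i l ω) P := by
  obtain ⟨φ, hφ, -⟩ := exists_comp_history (i := i) hY
  simp only [hφ]
  have : IsFiniteMeasure (P.map (history i k)) := by infer_instance
  exact (Integrable.of_finite (f := φ) (μ := P.map (history i k))).comp_measurable
    (measurable_history hi k)

theorem integral_expect (hi : ∀ k, Measurable (i k)) (hindep : iIndepFun i P)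
    {p : Fin m → ℝ} (hlaw : ∀ k j, P.real {ω | i k ω = j} = p j) {k : ℕ}
    {Y : (ℕ → Fin m) → ℝ} (hY : DependsOn Y (Set.Iio (k + 1))) :
    ∫ ω, Y (fun l => i l ω) ∂P = ∫ ω, expect p k Y (fun l => i l ω) ∂P := by
  classical
  have hZ := fun j => dependsOn_comp_update hY j
  have hind : IndepFun (history i k) (i k) P := by
    have h := hindep.indepFun_finset (Finset.range k) {k} (by simp) hi
    exact h.comp measurable_id (measurable_pi_apply (⟨k, Finset.mem_singleton_self k⟩ :
      ({k} : Finset ℕ)))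
  have hprod : ∀ j, ∫ ω, Y (Function.update (fun l => i l ω) k j) * (if i k ω = j then 1 else 0) ∂P
      = p j * ∫ ω, Y (Function.update (fun l => i l ω) k j) ∂P := by
    intro j
    obtain ⟨φ, hφ, -⟩ := exists_comp_history (i := i) (hZ j)
    simp only [hφ]
    have h2 : IndepFun (fun ω => φ (history i k ω)) (fun ω => if i k ω = j then (1 : ℝ) else 0) P :=
      hind.comp (φ := φ) (ψ := fun l : Fin m => if l = j then (1 : ℝ) else 0)
        Measurable.of_discrete Measurable.of_discrete
    rw [h2.integral_fun_mul_eq_mul_integral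
      ((Measurable.of_discrete (f := φ)).comp (measurable_history hi k)).aestronglyMeasurable
      ((Measurable.of_discrete (f := fun l : Fin m => if l = j then (1 : ℝ) else 0)).comp
        (hi k)).aestronglyMeasurable, mul_comm]
    congr 1
    have h3 : (fun ω => if i k ω = j then (1 : ℝ) else 0)
        = {ω | i k ω = j}.indicator fun _ => (1 : ℝ) := by
      ext ω; simp [Set.indicator_apply]
    have h4 : MeasurableSet {ω | i k ω = j} := hi k (measurableSet_singleton j)
    rw [h3, integral_indicator_const _ h4, hlaw, smul_eq_mul, mul_one]
  have hsum : ∀ ω, Y (fun l => i l ω)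
      = ∑ j, Y (Function.update (fun l => i l ω) k j) * (if i k ω = j then 1 else 0) := by
    intro ω
    rw [Finset.sum_eq_single (i k ω)]
    · rw [if_pos rfl, mul_one]
      congr 1
      exact (Function.update_eq_self k (fun l => i l ω)).symm
    · intro j _ hj
      rw [if_neg hj.symm, mul_zero]
    · simp
  have hint := fun j => integrable_of_dependsOn (P := P) hi (hZ j)
  calc ∫ ω, Y (fun l => i l ω) ∂P
      = ∫ ω, ∑ j, Y (Function.update (fun l => i l ω) k j) * (if i k ω = j then 1 else 0) ∂P := by
        simp only [← hsum]
    _ = ∑ j, ∫ ω, Y (Function.update (fun l => i l ω) k j) * (if i k ω = j then 1 else 0) ∂P := by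
        refine integral_finsetSum _ fun j _ => ?_
        have hm : Measurable fun ω => if i k ω = j then (1 : ℝ) else 0 :=
          (Measurable.of_discrete (f := fun l : Fin m => if l = j then (1 : ℝ) else 0)).comp (hi k)
        refine (hint j).mul_bdd (c := 1) hm.aestronglyMeasurable
          (ae_of_all _ fun ω => ?_)
        split_ifs <;> simp
    _ = ∑ j, ∫ ω, p j * Y (Function.update (fun l => i l ω) k j) ∂P := by
        simp only [hprod, integral_const_mul]
    _ = ∫ ω, expect p k Y (fun l => i l ω) ∂P :=
        (integral_finsetSum _ fun j _ => (hint j).const_mul (p j)).symm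

/-- A nonnegative supermartingale of functionals of the random indices converges almost surely. -/
theorem ae_tendsto_of_expect_le (hi : ∀ k, Measurable (i k)) (hindep : iIndepFun i P)
    {p : Fin m → ℝ} (hlaw : ∀ k j, P.real {ω | i k ω = j} = p j) (N : ℕ)
    (Z : ℕ → (ℕ → Fin m) → ℝ) (hdep : ∀ k, DependsOn (Z k) (Set.Iio (N + k)))
    (h0 : ∀ k w, 0 ≤ Z k w) (hstep : ∀ k w, expect p (N + k) (Z (k + 1)) w ≤ Z k w) :
    ∀ᵐ ω ∂P, ∃ c, Tendsto (fun k => Z k fun l => i l ω) atTop (𝓝 c) := by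
  classical
  let 𝒢 : Filtration ℕ ‹MeasurableSpace Ω› :=
    { seq := fun k => historyFiltration hi (N + k)
      mono' := fun k l hkl => (historyFiltration hi).mono (by omega)
      le' := fun k => (historyFiltration hi).le _ }
  have hint := fun k => integrable_of_dependsOn (P := P) hi (hdep k)
  have hsuper : Supermartingale (fun k ω => Z k fun l => i l ω) 𝒢 P := by
    refine supermartingale_of_setIntegral_succ_le
      (fun k => (measurable_of_dependsOn hi (hdep k)).stronglyMeasurable) hint ?_
    intro k s hs
    obtain ⟨t, -, rfl⟩ := hs
    set A : Set (ℕ → Fin m) := {w | (fun l : Finset.range (N + k) => w l) ∈ t} with hA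
    have hAdep : DependsOn (· ∈ A) (Set.Iio (N + k)) := by
      intro w w' h
      have : (fun l : Finset.range (N + k) => w l) = fun l : Finset.range (N + k) => w' l :=
        funext fun l => h l (Finset.mem_range.1 l.2)
      change ((fun l : Finset.range (N + k) => w l) ∈ t) = ((fun l : Finset.range (N + k) => w' l) ∈ t)
      rw [this]
    have hms : MeasurableSet (history i (N + k) ⁻¹' t) :=
      measurable_history hi _ (Set.toFinite t).measurableSet
    have hind : ∀ (Y : (ℕ → Fin m) → ℝ), (∫ ω in history i (N + k) ⁻¹' t, Y (fun l => i l ω) ∂P)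
        = ∫ ω, A.indicator Y (fun l => i l ω) ∂P := by
      intro Y
      rw [← integral_indicator hms]
      rfl
    have hA1 : DependsOn (· ∈ A) (Set.Iio (N + k + 1)) :=
      hAdep.mono (Set.Iio_subset_Iio (Nat.le_succ _))
    rw [hind, hind, integral_expect hi hindep hlaw (dependsOn_indicator hA1 (hdep (k + 1)))]
    refine integral_mono
      (integrable_of_dependsOn hi (dependsOn_expect (dependsOn_indicator hA1 (hdep (k + 1)))))
      (integrable_of_dependsOn hi (dependsOn_indicator hAdep (hdep k))) fun ω => ?_
    change expect p (N + k) (A.indicator (Z (k + 1))) _ ≤ _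
    rw [expect_indicator hAdep]
    exact Set.indicator_le_indicator (hstep k _)
  have hanti : ∀ k, ∫ ω, Z k (fun l => i l ω) ∂P ≤ ∫ ω, Z 0 (fun l => i l ω) ∂P := by
    intro k
    induction k with
    | zero => rfl
    | succ k ih =>
      refine le_trans ?_ ih
      rw [integral_expect hi hindep hlaw (hdep (k + 1))]
      exact integral_mono (integrable_of_dependsOn hi (dependsOn_expect (hdep (k + 1))))
        (hint k) fun ω => hstep k _
  have hbdd : ∀ k, eLpNorm ((-fun k ω => Z k fun l => i l ω) k) 1 P
      ≤ ((∫ ω, Z 0 (fun l => i l ω) ∂P).toNNReal : ENNReal) := by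
    intro k
    rw [Pi.neg_apply, eLpNorm_neg, eLpNorm_one_eq_lintegral_enorm,
      ← ofReal_integral_norm_eq_lintegral_enorm (hint k)]
    refine ENNReal.ofReal_le_ofReal ?_
    simp only [Real.norm_of_nonneg (h0 k _)]
    exact hanti k
  filter_upwards [hsuper.neg.exists_ae_tendsto_of_bdd hbdd] with ω hω
  obtain ⟨c, hc⟩ := hω
  exact ⟨-c, by simpa using hc.neg⟩

/-- The supermartingale convergence theorem with summable decrements, on an event `A` that is known
at time `N`: the decrements are compensated to get a second nonnegative supermartingale. -/
theorem ae_tendsto_and_summable (hi : ∀ k, Measurable (i k)) (hindep : iIndepFun i P)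
    {p : Fin m → ℝ} (hp1 : ∑ j, p j = 1)
    (hlaw : ∀ k j, P.real {ω | i k ω = j} = p j) (N : ℕ)
    {A : Set (ℕ → Fin m)} (hA : DependsOn (· ∈ A) (Set.Iio N))
    (Y R : ℕ → (ℕ → Fin m) → ℝ) (hY : ∀ k, DependsOn (Y k) (Set.Iio k))
    (hR : ∀ k, DependsOn (R k) (Set.Iio k))
    (hY0 : ∀ k w, N ≤ k → w ∈ A → 0 ≤ Y k w) (hR0 : ∀ k w, N ≤ k → w ∈ A → 0 ≤ R k w)
    (hstep : ∀ k w, N ≤ k → w ∈ A → expect p k (Y (k + 1)) w ≤ Y k w - R k w) :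
    ∀ᵐ ω ∂P, (fun l => i l ω) ∈ A →
      (∃ c, Tendsto (fun k => Y k fun l => i l ω) atTop (𝓝 c)) ∧
        Summable fun k => R (N + k) fun l => i l ω := by
  classical
  have hAk : ∀ k, DependsOn (· ∈ A) (Set.Iio (N + k)) := fun k =>
    hA.mono (Set.Iio_subset_Iio (Nat.le_add_right _ _))
  have hsum : ∀ k, DependsOn (fun w => ∑ l ∈ Finset.range k, R (N + l) w) (Set.Iio (N + k)) := by
    intro k w w' h
    refine Finset.sum_congr rfl fun l hl => hR (N + l) fun n hn => h n ?_
    have := Finset.mem_range.1 hl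
    have : n < N + l := hn
    show n < N + k
    omega
  have hsum' : ∀ k, DependsOn (fun w => ∑ l ∈ Finset.range (k + 1), R (N + l) w)
      (Set.Iio (N + k)) := by
    intro k w w' h
    refine Finset.sum_congr rfl fun l hl => hR (N + l) fun n hn => h n ?_
    have := Finset.mem_range.1 hl
    have : n < N + l := hn
    show n < N + k
    omega
  have h1 := ae_tendsto_of_expect_le hi hindep hlaw N (fun k => A.indicator (Y (N + k)))
    (fun k => dependsOn_indicator (hAk k) (hY _))
    (fun k w => Set.indicator_apply_nonneg fun hw => hY0 _ _ (Nat.le_add_right _ _) hw) (by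
      intro k w
      rw [expect_indicator (hAk k)]
      refine Set.indicator_le_indicator' fun hw => ?_
      have : expect p (N + k) (Y (N + (k + 1))) w ≤ Y (N + k) w - R (N + k) w :=
        hstep (N + k) w (Nat.le_add_right _ _) hw
      have := hR0 (N + k) w (Nat.le_add_right _ _) hw
      linarith)
  have h2 := ae_tendsto_of_expect_le hi hindep hlaw N
    (fun k => A.indicator fun w => Y (N + k) w + ∑ l ∈ Finset.range k, R (N + l) w)
    (fun k => dependsOn_indicator (hAk k) fun w w' h => by
      rw [hY (N + k) h]
      exact congrArg _ (hsum k h))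
    (fun k w => Set.indicator_apply_nonneg fun hw => add_nonneg (hY0 _ _ (Nat.le_add_right _ _) hw)
      (Finset.sum_nonneg fun l _ => hR0 _ _ (Nat.le_add_right _ _) hw)) (by
      intro k w
      rw [expect_indicator (hAk k)]
      refine Set.indicator_le_indicator' fun hw => ?_
      rw [expect_add_of_dependsOn hp1 (hsum' k), Finset.sum_range_succ]
      have : expect p (N + k) (Y (N + (k + 1))) w ≤ Y (N + k) w - R (N + k) w :=
        hstep (N + k) w (Nat.le_add_right _ _) hw
      linarith)
  filter_upwards [h1, h2] with ω hω1 hω2 hω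
  obtain ⟨c1, hc1⟩ := hω1
  obtain ⟨c2, hc2⟩ := hω2
  simp only [Set.indicator_of_mem hω] at hc1 hc2
  refine ⟨⟨c1, ?_⟩, ?_⟩
  · rw [← tendsto_add_atTop_iff_nat N]
    simpa only [add_comm N] using hc1
  · have h3 : Tendsto (fun k => ∑ l ∈ Finset.range k, R (N + l) fun l => i l ω) atTop
        (𝓝 (c2 - c1)) := by
      simpa using hc2.sub hc1
    exact ((hasSum_iff_tendsto_nat_of_nonneg
      (fun k => hR0 _ _ (Nat.le_add_right _ _) hω) _).2 h3).summable

/-- Almost surely every block with positive probability is drawn. -/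
theorem ae_exists_eq (hi : ∀ k, Measurable (i k)) (hindep : iIndepFun i P)
    {p : Fin m → ℝ} (hp1 : ∑ j, p j = 1)
    (hlaw : ∀ k j, P.real {ω | i k ω = j} = p j) (j : Fin m) (hp : ∀ j, 0 < p j) :
    ∀ᵐ ω ∂P, ∃ k, i k ω = j := by
  classical
  set Y : ℕ → (ℕ → Fin m) → ℝ := fun k w => if ∀ l < k, w l ≠ j then 1 else 0 with hYdef
  have hY : ∀ k, DependsOn (Y k) (Set.Iio k) := by
    intro k w w' h
    have : (∀ l < k, w l ≠ j) ↔ ∀ l < k, w' l ≠ j :=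
      forall₂_congr fun l hl => by rw [h l hl]
    simp only [hYdef, this]
  have hY0 : ∀ k w, 0 ≤ Y k w := by
    intro k w
    simp only [hYdef]
    split_ifs <;> simp
  have hstep : ∀ k w, expect p k (Y (k + 1)) w ≤ Y k w - p j * Y k w := by
    intro k w
    have h : ∀ l, p l * Y (k + 1) (Function.update w k l)
        ≤ p l * Y k w - if l = j then p j * Y k w else 0 := by
      intro l
      split_ifs with hl
      · subst hl
        have : Y (k + 1) (Function.update w k l) = 0 :=
          if_neg fun hc => hc k (Nat.lt_succ_self k) (by simp)
        rw [this]; simp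
      · have : Y (k + 1) (Function.update w k l) ≤ Y k w := by
          have h1 : Y k (Function.update w k l) = Y k w := dependsOn_update (hY k) w l
          rw [← h1]
          simp only [hYdef]
          split_ifs with h2 h3
          · rfl
          · exact absurd (fun n hn => h2 n (hn.trans (Nat.lt_succ_self k))) h3
          · exact zero_le_one
          · rfl
        rw [sub_zero]
        exact mul_le_mul_of_nonneg_left this (hp l).le
    calc expect p k (Y (k + 1)) w
        ≤ ∑ l, (p l * Y k w - if l = j then p j * Y k w else 0) := Finset.sum_le_sum fun l _ => h l
      _ = _ := by
        rw [Finset.sum_sub_distrib, ← Finset.sum_mul, hp1, one_mul]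
        simp
  have h := ae_tendsto_and_summable hi hindep hp1 hlaw 0 (A := Set.univ)
    (fun _ _ _ => rfl) Y (fun k w => p j * Y k w) hY
    (fun k w w' h => congrArg (p j * ·) (hY k h)) (fun k w _ _ => hY0 k w)
    (fun k w _ _ => mul_nonneg (hp j).le (hY0 k w)) (fun k w _ _ => hstep k w)
  filter_upwards [h] with ω hω
  by_contra hcon
  push Not at hcon
  have h1 : ∀ k, Y k (fun l => i l ω) = 1 := fun k => if_pos fun l _ => hcon l
  have h2 := (hω (Set.mem_univ _)).2.tendsto_atTop_zero
  simp only [h1, mul_one] at h2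
  exact (hp j).ne' (tendsto_nhds_unique tendsto_const_nhds h2)

end Expect

/-! ### Weak convergence in Hilbert spaces -/

section Weak

variable {H : Type*} [NormedAddCommGroup H] [InnerProductSpace ℝ H]

theorem norm_le_iff_denseSeq [TopologicalSpace.SeparableSpace H] {v : H} {r : ℝ} (hr : 0 ≤ r) :
    ‖v‖ ≤ r ↔ ∀ n, inner ℝ (TopologicalSpace.denseSeq H n) v
      ≤ r * ‖TopologicalSpace.denseSeq H n‖ := by
  constructor
  · intro h n
    refine (real_inner_le_norm _ _).trans ?_
    rw [mul_comm]
    gcongr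
  · intro h
    have hcl : IsClosed {u : H | inner ℝ u v ≤ r * ‖u‖} :=
      isClosed_le (by fun_prop) (by fun_prop)
    have hsub : closure (Set.range (TopologicalSpace.denseSeq H))
        ⊆ {u : H | inner ℝ u v ≤ r * ‖u‖} :=
      closure_minimal (by rintro _ ⟨n, rfl⟩; exact h n) hcl
    rw [(TopologicalSpace.denseRange_denseSeq H).closure_range] at hsub
    have hv : inner ℝ v v ≤ r * ‖v‖ := hsub (Set.mem_univ v)
    rw [real_inner_self_eq_norm_sq] at hv
    rcases eq_or_ne v 0 with h0 | h0
    · simpa [h0] using hr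
    · have := norm_pos_iff.2 h0
      nlinarith

/-- In a separable Hilbert space scalar measurability implies strong measurability: distances are
countable suprema of functionals, and they determine the preimages of open sets. -/
theorem stronglyMeasurable_of_inner [TopologicalSpace.SeparableSpace H] {Ω : Type*}
    [MeasurableSpace Ω] {x : Ω → H} (hx : ∀ u, Measurable fun ω => inner ℝ u (x ω)) :
    StronglyMeasurable x := by
  borelize H
  have := UniformSpace.secondCountable_of_separable H
  have hdist : ∀ c, Measurable fun ω => ‖x ω - c‖ := by
    intro c
    refine measurable_of_Iic fun r => ?_
    rcases lt_or_ge r 0 with hr | hr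
    · convert MeasurableSet.empty
      ext ω
      simpa using hr.trans_le (norm_nonneg _)
    · have : (fun ω => ‖x ω - c‖) ⁻¹' Set.Iic r
          = ⋂ n, {ω | inner ℝ (TopologicalSpace.denseSeq H n) (x ω)
            - inner ℝ (TopologicalSpace.denseSeq H n) c
              ≤ r * ‖TopologicalSpace.denseSeq H n‖} := by
        ext ω
        simp only [Set.mem_preimage, Set.mem_Iic, Set.mem_iInter]
        rw [norm_le_iff_denseSeq hr]
        simp only [inner_sub_right]
        rfl
      rw [this]
      exact MeasurableSet.iInter fun n =>
        measurableSet_le ((hx _).sub measurable_const) measurable_const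
  refine Measurable.stronglyMeasurable (measurable_of_isOpen fun O hO => ?_)
  have hO' : x ⁻¹' O = ⋃ (n : ℕ) (q : ℚ)
      (_ : Metric.ball (TopologicalSpace.denseSeq H n) q ⊆ O),
      {ω | ‖x ω - TopologicalSpace.denseSeq H n‖ < q} := by
    ext ω
    simp only [Set.mem_preimage, Set.mem_iUnion, exists_prop]
    constructor
    · intro hω
      obtain ⟨ε, hε, hball⟩ := Metric.isOpen_iff.1 hO _ hω
      obtain ⟨n, hn⟩ := (TopologicalSpace.denseRange_denseSeq H).exists_dist_lt (x ω)
        (half_pos hε)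
      obtain ⟨q, hq1, hq2⟩ := exists_rat_btwn hn
      refine ⟨n, q, fun y hy => hball ?_, by rwa [dist_eq_norm] at hq1⟩
      rw [Metric.mem_ball] at hy ⊢
      have := dist_triangle_right y (x ω) (TopologicalSpace.denseSeq H n)
      linarith
    · rintro ⟨n, q, hsub, hlt⟩
      exact hsub (by rw [Metric.mem_ball, dist_eq_norm]; exact hlt)
  rw [hO']
  exact MeasurableSet.iUnion fun n => MeasurableSet.iUnion fun q => MeasurableSet.iUnion fun _ =>
    measurableSet_lt (hdist _) measurable_const

variable [CompleteSpace H]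

theorem tendsto_toWeakSpace_iff {ι : Type*} {l : Filter ι} {x : ι → H} {y : H} :
    Tendsto (fun n => toWeakSpace ℝ H (x n)) l (𝓝 (toWeakSpace ℝ H y)) ↔
      ∀ u, Tendsto (fun n => inner ℝ u (x n)) l (𝓝 (inner ℝ u y)) := by
  have hinj : Function.Injective (topDualPairing ℝ H).flip := by
    intro a b hab
    refine ext_inner_left ℝ fun u => ?_
    exact DFunLike.congr_fun hab (InnerProductSpace.toDual ℝ H u)
  refine (WeakBilin.tendsto_iff_forall_eval_tendsto (B := (topDualPairing ℝ H).flip)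
    (f := fun n => x n) (x := y) hinj).trans ?_
  · constructor
    · intro h u
      exact h (InnerProductSpace.toDual ℝ H u)
    · intro h φ
      have := h ((InnerProductSpace.toDual ℝ H).symm φ)
      simp only [InnerProductSpace.toDual_symm_apply] at this
      exact this

/-- Bounded families have weak limits along ultrafilters, by the Banach–Alaoglu theorem. -/
theorem exists_weak_limit {ι : Type*} (U : Ultrafilter ι) {x : ι → H} {r : ℝ}
    (hx : ∀ n, ‖x n‖ ≤ r) :
    ∃ y, ∀ u, Tendsto (fun n => inner ℝ u (x n)) U (𝓝 (inner ℝ u y)) := by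
  have hc := WeakDual.isCompact_closedBall (𝕜 := ℝ) (0 : StrongDual ℝ H) r
  set ψ : ι → WeakDual ℝ H := fun n => StrongDual.toWeakDual (InnerProductSpace.toDual ℝ H (x n))
  obtain ⟨φ, -, hφ⟩ := hc.ultrafilter_le_nhds (U.map ψ) (by
    rw [Filter.le_principal_iff]
    refine Filter.mem_map.2 (Filter.univ_mem' fun n => ?_)
    simpa [ψ] using hx n)
  refine ⟨(InnerProductSpace.toDual ℝ H).symm (WeakDual.toStrongDual φ), fun u => ?_⟩
  have h : Tendsto (fun n => ψ n u) U (𝓝 (φ u)) :=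
    ((WeakDual.eval_continuous u).tendsto φ).comp hφ
  rw [real_inner_comm, InnerProductSpace.toDual_symm_apply]
  refine h.congr fun n => ?_
  rw [real_inner_comm]
  rfl

theorem mem_of_weak_tendsto {ι : Type*} {l : Filter ι} [l.NeBot] {C : Set H} (hC : Convex ℝ C)
    (hcl : IsClosed C) {x : ι → H} {y : H} (hx : ∀ᶠ n in l, x n ∈ C)
    (h : ∀ u, Tendsto (fun n => inner ℝ u (x n)) l (𝓝 (inner ℝ u y))) : y ∈ C := by
  have hw := hC.toWeakSpace_closure ℝ
  rw [hcl.closure_eq] at hw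
  have hclosed : IsClosed (toWeakSpace ℝ H '' C) := by
    rw [hw]; exact isClosed_closure
  obtain ⟨z, hz, hzy⟩ := hclosed.mem_of_tendsto (tendsto_toWeakSpace_iff.2 h)
    (hx.mono fun n hn => Set.mem_image_of_mem _ hn)
  rwa [← (toWeakSpace ℝ H).injective hzy]

/-- Opial's lemma in a weighted norm: if the weighted distances to the points of a dense subset `D`
of `S` converge and all weak cluster points lie in `S`, the sequence converges weakly to a point
of `S`. -/
theorem exists_weak_limit_of_opial {m : ℕ} {E : Fin m → Type*} [∀ i, NormedAddCommGroup (E i)]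
    [∀ i, InnerProductSpace ℝ (E i)] [∀ i, CompleteSpace (E i)] {x : ℕ → PiLp 2 E}
    {S D : Set (PiLp 2 E)} (hD : D.Nonempty) (hSD : S ⊆ closure D) {a : Fin m → ℝ}
    (ha : ∀ l, 0 < a l)
    (hconv : ∀ z ∈ D, ∃ c, Tendsto (fun k => ∑ l, a l * ‖x k l - z l‖ ^ 2) atTop (𝓝 c))
    (hcl : ∀ U : Ultrafilter ℕ, (U : Filter ℕ) ≤ atTop → ∀ y,
      (∀ u, Tendsto (fun k => inner ℝ u (x k)) U (𝓝 (inner ℝ u y))) → y ∈ S) :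
    ∃ y ∈ S, ∀ u, Tendsto (fun k => inner ℝ u (x k)) atTop (𝓝 (inner ℝ u y)) := by
  obtain ⟨r, hr⟩ : ∃ r, ∀ k, ‖x k‖ ≤ r := by
    obtain ⟨z, hz⟩ := hD
    obtain ⟨c, hc⟩ := hconv z hz
    obtain ⟨B, hB⟩ := hc.bddAbove_range
    refine ⟨√(∑ l, B / a l) + ‖z‖, fun k => ?_⟩
    have hk : ∑ l, a l * ‖x k l - z l‖ ^ 2 ≤ B := hB ⟨k, rfl⟩
    have hl : ∀ l, ‖x k l - z l‖ ^ 2 ≤ B / a l := by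
      intro l
      rw [le_div_iff₀ (ha l), mul_comm]
      refine le_trans (Finset.single_le_sum (f := fun l => a l * ‖x k l - z l‖ ^ 2)
        (fun l _ => ?_) (Finset.mem_univ l)) hk
      have := ha l
      positivity
    have h1 : ‖x k - z‖ ≤ √(∑ l, B / a l) := by
      refine Real.le_sqrt_of_sq_le ?_
      rw [PiLp.norm_sq_eq_of_L2]
      exact Finset.sum_le_sum fun l _ => hl l
    calc ‖x k‖ = ‖(x k - z) + z‖ := by rw [sub_add_cancel]
      _ ≤ ‖x k - z‖ + ‖z‖ := norm_add_le _ _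
      _ ≤ _ := by gcongr
  -- weak limits along two ultrafilters coincide
  have huniq : ∀ U V : Ultrafilter ℕ, (U : Filter ℕ) ≤ atTop → (V : Filter ℕ) ≤ atTop → ∀ y y',
      (∀ u, Tendsto (fun k => inner ℝ u (x k)) U (𝓝 (inner ℝ u y))) →
      (∀ u, Tendsto (fun k => inner ℝ u (x k)) V (𝓝 (inner ℝ u y'))) → y = y' := by
    intro U V hU hV y y' hy hy'
    set T : PiLp 2 E → ℝ := fun v => ∑ l, a l * inner ℝ (v l) (y l - y' l) with hT
    have hTcont : Continuous T := by
      refine continuous_finsetSum _ fun l _ => ?_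
      exact continuous_const.mul
        ((PiLp.continuous_apply 2 E l).inner continuous_const)
    have hTD : ∀ z ∈ D, ∀ z' ∈ D, T z = T z' := by
      intro z hz z' hz'
      obtain ⟨c, hc⟩ := hconv z hz
      obtain ⟨c', hc'⟩ := hconv z' hz'
      set w : PiLp 2 E := WithLp.toLp 2 fun l => a l • (z l - z' l) with hw
      have hinner : ∀ v : PiLp 2 E, inner ℝ w v = ∑ l, a l * inner ℝ (z l - z' l) (v l) := by
        intro v
        rw [PiLp.inner_apply]
        exact Finset.sum_congr rfl fun l _ => by simp [hw, inner_smul_left]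
      have hlin : ∀ k, inner ℝ w (x k) = (∑ l, a l * (‖z l‖ ^ 2 - ‖z' l‖ ^ 2)
          - (∑ l, a l * ‖x k l - z l‖ ^ 2 - ∑ l, a l * ‖x k l - z' l‖ ^ 2)) / 2 := by
        intro k
        rw [hinner, ← Finset.sum_sub_distrib, ← Finset.sum_sub_distrib, Finset.sum_div]
        refine Finset.sum_congr rfl fun l _ => ?_
        rw [norm_sub_sq_real, norm_sub_sq_real, inner_sub_left, real_inner_comm (x k l) (z l),
          real_inner_comm (x k l) (z' l)]
        ring
      have hlim : Tendsto (fun k => inner ℝ w (x k)) atTop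
          (𝓝 ((∑ l, a l * (‖z l‖ ^ 2 - ‖z' l‖ ^ 2) - (c - c')) / 2)) := by
        simp only [hlin]
        exact ((hc.sub hc').const_sub _).div_const 2
      have h1 := tendsto_nhds_unique (hy w) (hlim.mono_left hU)
      have h2 := tendsto_nhds_unique (hy' w) (hlim.mono_left hV)
      have h3 : inner ℝ w (y - y') = 0 := by rw [inner_sub_right, h1, h2, sub_self]
      rw [hinner] at h3
      refine sub_eq_zero.1 ?_
      rw [← h3, ← Finset.sum_sub_distrib]
      refine Finset.sum_congr rfl fun l _ => ?_
      rw [PiLp.sub_apply, ← mul_sub, ← inner_sub_left]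
    obtain ⟨z, hz⟩ := hD
    have hTS : ∀ v ∈ S, T v = T z := by
      have hclosed : IsClosed {v | T v = T z} := isClosed_eq hTcont continuous_const
      have := closure_minimal (fun v hv => hTD v hv z hz : D ⊆ {v | T v = T z}) hclosed
      exact fun v hv => this (hSD hv)
    have h0 : ∑ l, a l * ‖y l - y' l‖ ^ 2 = 0 := by
      have h1 := hTS y (hcl U hU y hy)
      have h2 := hTS y' (hcl V hV y' hy')
      have h3 : T y - T y' = 0 := by rw [h1, h2, sub_self]
      rw [← h3, hT]
      simp only
      rw [← Finset.sum_sub_distrib]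
      refine Finset.sum_congr rfl fun l _ => ?_
      rw [← mul_sub, ← inner_sub_left, real_inner_self_eq_norm_sq]
    ext l
    have h1 := (Finset.sum_eq_zero_iff_of_nonneg fun l _ =>
      mul_nonneg (ha l).le (sq_nonneg _)).1 h0 l (Finset.mem_univ l)
    have h2 : ‖y l - y' l‖ = 0 := by
      simpa [(ha l).ne'] using h1
    exact sub_eq_zero.1 (norm_eq_zero.1 h2)
  obtain ⟨y, hy⟩ := exists_weak_limit (Ultrafilter.of atTop) hr
  refine ⟨y, hcl _ (Ultrafilter.of_le _) y hy, fun u => ?_⟩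
  rw [tendsto_iff_ultrafilter]
  intro V hV
  obtain ⟨y', hy'⟩ := exists_weak_limit V hr
  rw [huniq _ V (Ultrafilter.of_le _) hV y y' hy hy']
  exact hy' u

end Weak

/-! ### Trajectories as functions of the index sequence -/

section Trajectory

variable {m : ℕ} {E : Fin m → Type*}

theorem delayed_congr {x y : ℕ → PiLp 2 E} {k : ℕ} (h : ∀ n ≤ k, x n = y n) (d : Fin m → ℕ) :
    delayed x k d = delayed y k d := by
  ext j
  change x (k - d j) j = y (k - d j) j
  rw [h _ (Nat.sub_le _ _)]

variable [∀ i, NormedAddCommGroup (E i)]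

/-- The sum of the squared lengths of the last `τ` steps before time `k`. -/
noncomputable def windowSq (x : ℕ → PiLp 2 E) (τ k : ℕ) : ℝ :=
  ∑ h ∈ Finset.Ico (k - τ) k, ‖x (h + 1) - x h‖ ^ 2

/-- The squared lengths of the last `τ` steps before time `k`, weighted by the number of times they
will still count in `windowSq`. The truncated subtraction gives the older steps weight zero. -/
noncomputable def windowWeighted (x : ℕ → PiLp 2 E) (τ k : ℕ) : ℝ :=
  ∑ h ∈ Finset.range k, ((h + τ + 1 - k : ℕ) : ℝ) * ‖x (h + 1) - x h‖ ^ 2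

theorem windowSq_nonneg (x : ℕ → PiLp 2 E) (τ k : ℕ) : 0 ≤ windowSq x τ k :=
  Finset.sum_nonneg fun _ _ => sq_nonneg _

theorem windowWeighted_nonneg (x : ℕ → PiLp 2 E) (τ k : ℕ) : 0 ≤ windowWeighted x τ k :=
  Finset.sum_nonneg fun _ _ => by positivity

theorem windowWeighted_zero (x : ℕ → PiLp 2 E) (τ : ℕ) : windowWeighted x τ 0 = 0 := by
  simp [windowWeighted]

theorem windowSq_eq_sum_range (x : ℕ → PiLp 2 E) (τ k : ℕ) :
    windowSq x τ k
      = ∑ h ∈ Finset.range k, if k ≤ h + τ then ‖x (h + 1) - x h‖ ^ 2 else 0 := by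
  rw [windowSq, ← Finset.sum_filter]
  refine Finset.sum_congr ?_ fun _ _ => rfl
  ext h
  simp only [Finset.mem_Ico, Finset.mem_filter, Finset.mem_range]
  omega

theorem windowWeighted_succ (x : ℕ → PiLp 2 E) (τ k : ℕ) :
    windowWeighted x τ (k + 1)
      = windowWeighted x τ k - windowSq x τ k + τ * ‖x (k + 1) - x k‖ ^ 2 := by
  rw [windowSq_eq_sum_range, windowWeighted, windowWeighted, Finset.sum_range_succ,
    ← Finset.sum_sub_distrib]
  congr 1
  · refine Finset.sum_congr rfl fun h _ => ?_
    split_ifs with hk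
    · have : h + τ + 1 - k = (h + τ + 1 - (k + 1)) + 1 := by omega
      rw [this]; push_cast; ring
    · rw [show h + τ + 1 - k = 0 by omega, show h + τ + 1 - (k + 1) = 0 by omega]; simp
  · rw [show k + τ + 1 - (k + 1) = τ by omega]

theorem windowWeighted_le (x : ℕ → PiLp 2 E) (τ k : ℕ) :
    windowWeighted x τ k ≤ τ * windowSq x τ k := by
  rw [windowSq_eq_sum_range, windowWeighted, Finset.mul_sum]
  refine Finset.sum_le_sum fun h hh => ?_
  have hlt := Finset.mem_range.1 hh
  split_ifs with hk
  · gcongr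
    omega
  · rw [show h + τ + 1 - k = 0 by omega]; simp

theorem sq_sum_norm_le (x : ℕ → PiLp 2 E) (τ k : ℕ) :
    (∑ h ∈ Finset.Ico (k - τ) k, ‖x (h + 1) - x h‖) ^ 2 ≤ τ * windowSq x τ k := by
  refine sq_sum_le_card_mul_sum_sq.trans ?_
  have : (Finset.Ico (k - τ) k).card ≤ τ := by rw [Nat.card_Ico]; omega
  exact mul_le_mul_of_nonneg_right (by exact_mod_cast this) (windowSq_nonneg x τ k)

theorem windowWeighted_congr {x y : ℕ → PiLp 2 E} {k : ℕ} (h : ∀ n ≤ k, x n = y n) (τ : ℕ) :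
    windowWeighted x τ k = windowWeighted y τ k := by
  refine Finset.sum_congr rfl fun n hn => ?_
  have := Finset.mem_range.1 hn
  rw [h n (by omega), h (n + 1) (by omega)]

variable [∀ i, InnerProductSpace ℝ (E i)] [∀ i, CompleteSpace (E i)]
  {f : PiLp 2 E → ℝ} {g : (i : Fin m) → E i → EReal} {γ : Fin m → ℝ} {d : ℕ → Fin m → ℕ}
  {x0 : PiLp 2 E}

theorem IsAsyncFB.succ_eq {w : ℕ → Fin m} {x : ℕ → PiLp 2 E} (h : IsAsyncFB f g γ d x0 w x)
    (k : ℕ) : x (k + 1)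
      = setBlock (x k) (w k) (fbPoint f g γ (x k) (delayed x k (d k)) (w k)) :=
  h.2 k

/-- The iterate at time `k` is determined by the indices before `k`. -/
theorem IsAsyncFB.congr {w w' : ℕ → Fin m} {x x' : ℕ → PiLp 2 E}
    (h : IsAsyncFB f g γ d x0 w x) (h' : IsAsyncFB f g γ d x0 w' x') (k : ℕ)
    (hw : ∀ l < k, w l = w' l) : ∀ n ≤ k, x n = x' n := by
  induction k with
  | zero =>
    intro n hn
    rw [Nat.le_zero.1 hn, h.1, h'.1]
  | succ k ih =>
    have ih' := ih fun l hl => hw l (hl.trans (Nat.lt_succ_self k))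
    intro n hn
    rcases hn.lt_or_eq with hn | rfl
    · exact ih' n (Nat.lt_succ_iff.1 hn)
    · rw [h.succ_eq, h'.succ_eq, ih' k le_rfl, delayed_congr ih', hw k (Nat.lt_succ_self k)]

theorem exists_isAsyncFB (f : PiLp 2 E → ℝ) (g : (i : Fin m) → E i → EReal) (γ : Fin m → ℝ)
    (d : ℕ → Fin m → ℕ) (x0 : PiLp 2 E) (w : ℕ → Fin m) :
    ∃ x, IsAsyncFB f g γ d x0 w x := by
  classical
  -- stage `k` of the recursion carries all the iterates up to time `k`
  let T : ℕ → ℕ → PiLp 2 E := fun k => Nat.rec (fun _ => x0) (fun k y => Function.update y (k + 1)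
    (setBlock (y k) (w k) (fbPoint f g γ (y k) (delayed y k (d k)) (w k)))) k
  have hT : ∀ k, T (k + 1) = Function.update (T k) (k + 1)
      (setBlock (T k k) (w k) (fbPoint f g γ (T k k) (delayed (T k) k (d k)) (w k))) :=
    fun k => rfl
  have hstable : ∀ k, ∀ n ≤ k, T k n = T n n := by
    intro k
    induction k with
    | zero => intro n hn; rw [Nat.le_zero.1 hn]
    | succ k ih =>
      intro n hn
      rcases hn.lt_or_eq with hn | rfl
      · rw [hT, Function.update_of_ne hn.ne]
        exact ih n (Nat.lt_succ_iff.1 hn)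
      · rfl
  refine ⟨fun k => T k k, rfl, fun k => ?_⟩
  change T (k + 1) (k + 1) = setBlock (T k k) (w k)
    (fbPoint f g γ (T k k) (delayed (fun k => T k k) k (d k)) (w k))
  rw [hT, Function.update_self, delayed_congr (y := fun k => T k k) (hstable k)]

theorem IsAsyncFB.ne_top_of_le {w : ℕ → Fin m} {x : ℕ → PiLp 2 E}
    (h : IsAsyncFB f g γ d x0 w x) (hg : ∀ i, Proper (g i)) (hgc : ∀ i, ConvexFun (g i))
    (hgl : ∀ i, LowerSemicontinuous (g i)) (hγ : ∀ j, 0 < γ j) {j : Fin m} {n k : ℕ}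
    (hnk : n ≤ k) (hn : g j (x n j) ≠ ⊤) : g j (x k j) ≠ ⊤ := by
  induction k, hnk using Nat.le_induction with
  | base => exact hn
  | succ k _ ih =>
    rw [h.succ_eq]
    by_cases hj : j = w k
    · subst hj
      rw [setBlock_same]
      exact fbPoint_ne_top hg hgc hgl hγ _ _ _
    · rwa [setBlock_of_ne _ hj]

/-- Once every block has been drawn, the iterates stay in the domain of the objective. -/
theorem IsAsyncFB.exists_forall_ne_top {w : ℕ → Fin m} {x : ℕ → PiLp 2 E}
    (h : IsAsyncFB f g γ d x0 w x) (hg : ∀ i, Proper (g i)) (hgc : ∀ i, ConvexFun (g i))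
    (hgl : ∀ i, LowerSemicontinuous (g i)) (hγ : ∀ j, 0 < γ j) (hw : ∀ j, ∃ k, w k = j) :
    ∃ N, ∀ j, g j (x N j) ≠ ⊤ := by
  choose κ hκ using hw
  refine ⟨∑ j, (κ j + 1), fun j => h.ne_top_of_le hg hgc hgl hγ (n := κ j + 1)
    (Finset.single_le_sum (f := fun j => κ j + 1) (fun _ _ => Nat.zero_le _)
      (Finset.mem_univ j)) ?_⟩
  rw [h.succ_eq]
  have hj : j = w (κ j) := (hκ j).symm
  generalize w (κ j) = l at hj
  subst hj
  rw [setBlock_same]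
  exact fbPoint_ne_top hg hgc hgl hγ _ _ _

end Trajectory

/-! ### The Lyapunov functional along the trajectories -/

section Lyapunov

variable {m : ℕ} {E : Fin m → Type*} [∀ i, NormedAddCommGroup (E i)]

/-- The constant of the rate in terms of `δ`, `pm`, `c` and `τ`. -/
noncomputable def lyapunovConst (pm c δ : ℝ) (τ : ℕ) : ℝ :=
  max 1 (2 - δ)⁻¹ / pm - 1 + τ * (1 / (√pm * (2 - δ))) * (1 + c)

/-- The objective augmented by the weighted squares of the recent steps. -/
noncomputable def augmented (f : PiLp 2 E → ℝ) (g : (i : Fin m) → E i → EReal) (K : ℝ≥0) (c : ℝ)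
    (τ : ℕ) (x : ℕ → PiLp 2 E) (k : ℕ) : ℝ :=
  realObjective f g (x k) + K * c / 2 * windowWeighted x τ k

/-- The Lyapunov functional: half the squared weighted distance to `z`, plus multiples of the
augmented objective gap and of the recent squared steps. -/
noncomputable def lyapunov (f : PiLp 2 E → ℝ) (g : (i : Fin m) → E i → EReal) (K : ℝ≥0)
    (γ p : Fin m → ℝ) (pm c δ : ℝ) (τ : ℕ) (z : PiLp 2 E) (x : ℕ → PiLp 2 E) (k : ℕ) : ℝ :=
  1 / 2 * ∑ l, 1 / (γ l * p l) * ‖x k l - z l‖ ^ 2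
    + lyapunovConst pm c δ τ * (augmented f g K c τ x k - realObjective f g z)
    + (1 + c) * (K * τ / 2) * windowWeighted x τ k

variable {f : PiLp 2 E → ℝ} {g : (i : Fin m) → E i → EReal} {K : ℝ≥0} {L : Fin m → ℝ≥0}
  {γ p : Fin m → ℝ} {pm pM c δ : ℝ} {τ : ℕ} {d : ℕ → Fin m → ℕ} {x0 : PiLp 2 E}

theorem augmented_congr {x y : ℕ → PiLp 2 E} {k : ℕ} (h : ∀ n ≤ k, x n = y n) :
    augmented f g K c τ x k = augmented f g K c τ y k := by
  rw [augmented, augmented, h k le_rfl, windowWeighted_congr h]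

theorem lyapunov_congr {x y : ℕ → PiLp 2 E} {z : PiLp 2 E} {k : ℕ} (h : ∀ n ≤ k, x n = y n) :
    lyapunov f g K γ p pm c δ τ z x k = lyapunov f g K γ p pm c δ τ z y k := by
  rw [lyapunov, lyapunov, h k le_rfl, windowWeighted_congr h, augmented_congr h]

variable [∀ i, InnerProductSpace ℝ (E i)] [∀ i, CompleteSpace (E i)]

/-- The standing assumptions on the problem and the parameters. The numbers `pm` and `pM` bound the
probabilities, and `c` bounds both `√pm` and `√pM` from above. -/
structure Setting (f : PiLp 2 E → ℝ) (g : (i : Fin m) → E i → EReal) (K : ℝ≥0) (L : Fin m → ℝ≥0)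
    (γ p : Fin m → ℝ) (pm pM c δ : ℝ) (τ : ℕ) (d : ℕ → Fin m → ℕ) : Prop where
  convexOn : ConvexOn ℝ Set.univ f
  differentiable : Differentiable ℝ f
  proper : ∀ i, Proper (g i)
  convexFun : ∀ i, ConvexFun (g i)
  lsc : ∀ i, LowerSemicontinuous (g i)
  lipschitz : ∀ (x : PiLp 2 E) (i : Fin m), LipschitzWith K fun v : E i => ∇ f (setBlock x i v)
  lipschitz_block : ∀ (x : PiLp 2 E) (i : Fin m),
    LipschitzWith (L i) fun v : E i => (∇ f (setBlock x i v)) i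
  step_pos : ∀ j, 0 < γ j
  sum_prob : ∑ j, p j = 1
  pm_pos : 0 < pm
  pm_le : ∀ j, pm ≤ p j
  le_pM : ∀ j, p j ≤ pM
  c_pos : 0 < c
  sqrt_pm_le : √pm ≤ c
  pM_le : pM ≤ c ^ 2
  δ_lt : δ < 2
  le_δ : ∀ j, L j * γ j + 2 * γ j * τ * K * c ≤ δ
  delay : ∀ k j, d k j ≤ min k τ

theorem Setting.prob_pos (hs : Setting f g K L γ p pm pM c δ τ d) (j : Fin m) : 0 < p j :=
  hs.pm_pos.trans_le (hs.pm_le j)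

theorem Setting.lyapunovConst_nonneg (hs : Setting f g K L γ p pm pM c δ τ d) (j : Fin m) :
    0 ≤ lyapunovConst pm c δ τ := by
  have h0 := hs.pm_pos
  have hp1 : p j ≤ 1 := hs.sum_prob ▸
    Finset.single_le_sum (fun l _ => (hs.prob_pos l).le) (Finset.mem_univ j)
  have h1 : 1 ≤ max 1 (2 - δ)⁻¹ / pm := by
    rw [le_div_iff₀ h0, one_mul]
    exact ((hs.pm_le j).trans hp1).trans (le_max_left _ _)
  have h2 : 0 ≤ τ * (1 / (√pm * (2 - δ))) * (1 + c) := by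
    have := hs.δ_lt
    have := hs.c_pos
    have h3 : 0 < 2 - δ := by linarith
    positivity
  rw [lyapunovConst]
  linarith

variable {X : (ℕ → Fin m) → ℕ → PiLp 2 E}

theorem trajectory_update_eq (hX : ∀ w, IsAsyncFB f g γ d x0 w (X w))
    (w : ℕ → Fin m) (k : ℕ) (j : Fin m) :
    (∀ n ≤ k, X (Function.update w k j) n = X w n) ∧
      X (Function.update w k j) (k + 1)
        = setBlock (X w k) j (fbPoint f g γ (X w k) (delayed (X w) k (d k)) j) := by
  have h1 := (hX (Function.update w k j)).congr (hX w) k fun l hl => update_eq_of_lt hl w j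
  refine ⟨h1, ?_⟩
  rw [(hX _).succ_eq, h1 k le_rfl, delayed_congr h1, Function.update_self]

theorem dependsOn_trajectory (hX : ∀ w, IsAsyncFB f g γ d x0 w (X w))
    (k : ℕ) {β : Type*} {Φ : (ℕ → PiLp 2 E) → β}
    (hΦ : ∀ x y : ℕ → PiLp 2 E, (∀ n ≤ k, x n = y n) → Φ x = Φ y) :
    DependsOn (fun w => Φ (X w)) (Set.Iio k) :=
  fun _ _ h => hΦ _ _ ((hX _).congr (hX _) k h)

/-- The one-step inequalities along a trajectory. -/
theorem expect_lyapunov_le (hX : ∀ w, IsAsyncFB f g γ d x0 w (X w))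
    (hs : Setting f g K L γ p pm pM c δ τ d) {z : PiLp 2 E}
    (hz : ∀ j, g j (z j) ≠ ⊤) (w : ℕ → Fin m) (k : ℕ) (hw : ∀ j, g j (X w k j) ≠ ⊤) :
    expect p k (fun w => augmented f g K c τ (X w) (k + 1)) w ≤ augmented f g K c τ (X w) k ∧
    expect p k (fun w => lyapunov f g K γ p pm c δ τ z (X w) (k + 1)) w
      ≤ lyapunov f g K γ p pm c δ τ z (X w) k
        - (expect p k (fun w => augmented f g K c τ (X w) (k + 1)) w - realObjective f g z) := by
  have hblock : ∀ l, X w (l + 1) = setBlock (X w l) (w l) (X w (l + 1) (w l)) := by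
    intro l
    conv_rhs => rw [(hX w).succ_eq, setBlock_same]
    exact (hX w).succ_eq l
  obtain ⟨hgrad, hbreg⟩ := delayed_bound hs.differentiable hs.lipschitz (X w) w hblock (hs.delay k)
  have hone := one_step hs.convexOn hs.differentiable hs.proper hs.convexFun hs.lsc
    hs.lipschitz_block hs.step_pos hs.sum_prob hs.pm_pos hs.pm_le hs.le_pM hs.c_pos hs.sqrt_pm_le
    hs.pM_le K.2 (Nat.cast_nonneg τ) hs.δ_lt hs.le_δ hw hz (windowSq_nonneg (X w) τ k)
    (sq_sum_norm_le (X w) τ k) (windowWeighted_le (X w) τ k) hgrad hbreg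
  have hwin : ∀ j, windowWeighted (X (Function.update w k j)) τ (k + 1)
      = windowWeighted (X w) τ k - windowSq (X w) τ k
        + τ * ‖fbPoint f g γ (X w k) (delayed (X w) k (d k)) j - X w k j‖ ^ 2 := by
    intro j
    obtain ⟨h1, h2⟩ := trajectory_update_eq hX w k j
    have h3 : windowSq (X (Function.update w k j)) τ k = windowSq (X w) τ k := by
      refine Finset.sum_congr rfl fun n hn => ?_
      have := Finset.mem_Ico.1 hn
      rw [h1 n (by omega), h1 (n + 1) (by omega)]
    rw [windowWeighted_succ, windowWeighted_congr h1, h3, h2, h1 k le_rfl, norm_setBlock_sub]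
  have haug : ∀ j, augmented f g K c τ (X (Function.update w k j)) (k + 1)
      = realObjective f g (setBlock (X w k) j (fbPoint f g γ (X w k) (delayed (X w) k (d k)) j))
        + K * c / 2 * (windowWeighted (X w) τ k - windowSq (X w) τ k
          + τ * ‖fbPoint f g γ (X w k) (delayed (X w) k (d k)) j - X w k j‖ ^ 2) := by
    intro j
    rw [augmented, hwin, (trajectory_update_eq hX w k j).2]
  simp only [expect, lyapunov, haug, hwin, (trajectory_update_eq hX w k _).2]
  exact hone

end Lyapunov

/-! ### Almost sure convergence and rates -/

section Convergence

variable {m : ℕ} {E : Fin m → Type*} [∀ i, NormedAddCommGroup (E i)]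
  [∀ i, InnerProductSpace ℝ (E i)] [∀ i, CompleteSpace (E i)]
  {f : PiLp 2 E → ℝ} {g : (i : Fin m) → E i → EReal} {K : ℝ≥0} {L : Fin m → ℝ≥0}
  {γ p : Fin m → ℝ} {pm pM c δ : ℝ} {τ : ℕ} {d : ℕ → Fin m → ℕ} {x0 : PiLp 2 E}
  {X : (ℕ → Fin m) → ℕ → PiLp 2 E}
  {Ω : Type*} [MeasurableSpace Ω] {P : Measure Ω} [IsProbabilityMeasure P] {i : ℕ → Ω → Fin m}

theorem Setting.realObjective_le_augmented (hs : Setting f g K L γ p pm pM c δ τ d)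
    (x : ℕ → PiLp 2 E) (k : ℕ) : realObjective f g (x k) ≤ augmented f g K c τ x k := by
  have h1 := windowWeighted_nonneg x τ k
  have h2 := hs.c_pos
  have : 0 ≤ (K : ℝ) * c / 2 * windowWeighted x τ k := by positivity
  rw [augmented]
  linarith

theorem Setting.lyapunov_nonneg (hs : Setting f g K L γ p pm pM c δ τ d) {z : PiLp 2 E}
    (hz : z ∈ argmin (objective f g)) {x : ℕ → PiLp 2 E} {k : ℕ} (hx : ∀ j, g j (x k j) ≠ ⊤)
    (j : Fin m) : 0 ≤ lyapunov f g K γ p pm c δ τ z x k := by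
  have h1 := windowWeighted_nonneg x τ k
  have h2 := hs.c_pos
  have h3 := hs.lyapunovConst_nonneg j
  have h4 := realObjective_argmin_le hs.proper hz hx
  have h5 := hs.realObjective_le_augmented x k
  have h6 : 0 ≤ augmented f g K c τ x k - realObjective f g z := by linarith
  have h7 : 0 ≤ ∑ l, 1 / (γ l * p l) * ‖x k l - z l‖ ^ 2 :=
    Finset.sum_nonneg fun l _ => by
      have := hs.step_pos l
      have := hs.prob_pos l
      positivity
  rw [lyapunov]
  positivity

/-- On the event that the iterate at time `N` lies in the domain, almost surely the weighted
distance to a minimizer converges and the objective values tend to the minimum. -/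
theorem ae_tendsto_dist_and_objective (hX : ∀ w, IsAsyncFB f g γ d x0 w (X w))
    (hs : Setting f g K L γ p pm pM c δ τ d) (hi : ∀ k, Measurable (i k))
    (hindep : iIndepFun i P) (hlaw : ∀ k j, P.real {ω | i k ω = j} = p j) {z : PiLp 2 E}
    (hz : z ∈ argmin (objective f g)) (N : ℕ) :
    ∀ᵐ ω ∂P, (∀ j, g j (X (fun l => i l ω) N j) ≠ ⊤) →
      (∃ a, Tendsto (fun k => ∑ l, 1 / (γ l * p l) * ‖X (fun l => i l ω) k l - z l‖ ^ 2)
        atTop (𝓝 a)) ∧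
      Tendsto (fun k => realObjective f g (X (fun l => i l ω) k)) atTop
        (𝓝 (realObjective f g z)) := by
  obtain ⟨ω0⟩ : Nonempty Ω := P.nonempty_of_neZero
  have j0 : Fin m := i 0 ω0
  have hzd := argmin_ne_top hs.proper hz
  set Fz := realObjective f g z with hFz
  set A : Set (ℕ → Fin m) := {w | ∀ j, g j (X w N j) ≠ ⊤} with hA
  have hdom : ∀ k w, N ≤ k → w ∈ A → ∀ j, g j (X w k j) ≠ ⊤ := fun k w hk hw j =>
    (hX w).ne_top_of_le hs.proper hs.convexFun hs.lsc hs.step_pos hk (hw j)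
  have hAdep : DependsOn (· ∈ A) (Set.Iio N) :=
    dependsOn_trajectory hX N (Φ := fun x => ∀ j, g j (x N j) ≠ ⊤)
      fun x y h => by rw [h N le_rfl]
  set V : ℕ → (ℕ → Fin m) → ℝ := fun k w => lyapunov f g K γ p pm c δ τ z (X w) k with hV
  set R : ℕ → (ℕ → Fin m) → ℝ := fun k w => augmented f g K c τ (X w) k - Fz with hR
  have hVdep : ∀ k, DependsOn (V k) (Set.Iio k) := fun k =>
    dependsOn_trajectory hX k fun x y h => lyapunov_congr h
  have hRdep : ∀ k, DependsOn (R k) (Set.Iio k) := fun k =>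
    dependsOn_trajectory hX k (Φ := fun x => augmented f g K c τ x k - Fz)
      fun x y h => by rw [augmented_congr h]
  have hF : ∀ k w, N ≤ k → w ∈ A → Fz ≤ realObjective f g (X w k) := fun k w hk hw =>
    realObjective_argmin_le hs.proper hz (hdom k w hk hw)
  have hR0 : ∀ k w, N ≤ k → w ∈ A → 0 ≤ R k w := by
    intro k w hk hw
    have h1 := hF k w hk hw
    have h2 := hs.realObjective_le_augmented (X w) k
    simp only [hR]
    linarith
  have hstep : ∀ k w, N ≤ k → w ∈ A →
      expect p k (fun w => V (k + 1) w + R (k + 1) w) w ≤ V k w + R k w - R k w := by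
    intro k w hk hw
    have h := (expect_lyapunov_le hX hs hzd w k (hdom k w hk hw)).2
    have h1 : expect p k (fun w => V (k + 1) w + R (k + 1) w) w
        = expect p k (V (k + 1)) w
          + (expect p k (fun w => augmented f g K c τ (X w) (k + 1)) w - Fz) := by
      simp only [expect, hR, mul_add, mul_sub, Finset.sum_add_distrib, Finset.sum_sub_distrib]
      rw [← Finset.sum_mul, hs.sum_prob, one_mul]
    rw [h1]
    simp only [hV]
    linarith
  have h := ae_tendsto_and_summable hi hindep hs.sum_prob hlaw N hAdep
    (fun k w => V k w + R k w) R
    (fun k w w' h => congrArg₂ (· + ·) (hVdep k h) (hRdep k h)) hRdep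
    (fun k w hk hw => add_nonneg (hs.lyapunov_nonneg hz (hdom k w hk hw) j0) (hR0 k w hk hw))
    hR0 hstep
  filter_upwards [h] with ω hω hωA
  obtain ⟨⟨a, ha⟩, hsum⟩ := hω hωA
  set w : ℕ → Fin m := fun l => i l ω with hw
  have hRlim : Tendsto (fun k => R k w) atTop (𝓝 0) := by
    rw [← tendsto_add_atTop_iff_nat N]
    simpa only [add_comm N] using hsum.tendsto_atTop_zero
  have hFlim : Tendsto (fun k => realObjective f g (X w k)) atTop (𝓝 Fz) := by
    have hup : Tendsto (fun k => R k w + Fz) atTop (𝓝 Fz) := by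
      simpa using hRlim.add_const Fz
    refine tendsto_of_tendsto_of_tendsto_of_le_of_le' tendsto_const_nhds hup ?_ ?_
    · filter_upwards [eventually_ge_atTop N] with k hk using hF k w hk hωA
    · refine Eventually.of_forall fun k => ?_
      have := hs.realObjective_le_augmented (X w) k
      simp only [hR]
      linarith
  refine ⟨?_, hFlim⟩
  refine ⟨2 * a, ?_⟩
  have hQ : Tendsto (fun k => (K : ℝ) * windowWeighted (X w) τ k) atTop (𝓝 0) := by
    have h1 : ∀ k, (K : ℝ) * windowWeighted (X w) τ k
        = 2 / c * (R k w + Fz - realObjective f g (X w k)) := by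
      intro k
      have := hs.c_pos.ne'
      simp only [hR, augmented]
      field_simp
      ring
    simp only [h1]
    simpa using ((hRlim.add_const Fz).sub hFlim).const_mul (2 / c)
  have h1 : ∀ k, ∑ l, 1 / (γ l * p l) * ‖X w k l - z l‖ ^ 2
      = 2 * (V k w + R k w - (lyapunovConst pm c δ τ + 1) * R k w
        - (1 + c) * (τ / 2) * (K * windowWeighted (X w) τ k)) := by
    intro k
    simp only [hV, hR, lyapunov]
    ring
  simp only [h1]
  simpa using (((ha.sub (hRlim.const_mul (lyapunovConst pm c δ τ + 1))).sub
    (hQ.const_mul ((1 + c) * (τ / 2)))).const_mul 2)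

/-- Almost surely the iterates converge weakly to a minimizer. -/
theorem ae_exists_weak_limit [∀ i, TopologicalSpace.SeparableSpace (E i)]
    (hX : ∀ w, IsAsyncFB f g γ d x0 w (X w))
    (hs : Setting f g K L γ p pm pM c δ τ d) (hi : ∀ k, Measurable (i k))
    (hindep : iIndepFun i P) (hlaw : ∀ k j, P.real {ω | i k ω = j} = p j)
    (hmin : (argmin (objective f g)).Nonempty) :
    ∀ᵐ ω ∂P, ∃ y ∈ argmin (objective f g), ∀ u,
      Tendsto (fun k => inner ℝ u (X (fun l => i l ω) k)) atTop (𝓝 (inner ℝ u y)) := by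
  have (i : Fin m) : SecondCountableTopology (E i) := UniformSpace.secondCountable_of_separable _
  obtain ⟨D, hDS, hDc, hSD⟩ := (TopologicalSpace.IsSeparable.of_separableSpace
    (argmin (objective f g))).exists_countable_dense_subset
  have hDne : D.Nonempty := closure_nonempty_iff.1 (hmin.mono hSD)
  have hall : ∀ᵐ ω ∂P, ∀ z ∈ D, ∀ N, (∀ j, g j (X (fun l => i l ω) N j) ≠ ⊤) →
      (∃ a, Tendsto (fun k => ∑ l, 1 / (γ l * p l) * ‖X (fun l => i l ω) k l - z l‖ ^ 2)
        atTop (𝓝 a)) ∧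
      Tendsto (fun k => realObjective f g (X (fun l => i l ω) k)) atTop
        (𝓝 (realObjective f g z)) := by
    rw [ae_ball_iff hDc]
    intro z hz
    rw [ae_all_iff]
    exact fun N => ae_tendsto_dist_and_objective hX hs hi hindep hlaw (hDS hz) N
  have hdraw : ∀ᵐ ω ∂P, ∀ j, ∃ k, i k ω = j :=
    ae_all_iff.2 fun j => ae_exists_eq hi hindep hs.sum_prob hlaw j hs.prob_pos
  filter_upwards [hall, hdraw] with ω hω hωd
  set w : ℕ → Fin m := fun l => i l ω with hw
  obtain ⟨N, hN⟩ := (hX w).exists_forall_ne_top hs.proper hs.convexFun hs.lsc hs.step_pos hωd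
  refine exists_weak_limit_of_opial hDne hSD (a := fun l => 1 / (γ l * p l))
    (fun l => by have := hs.step_pos l; have := hs.prob_pos l; positivity)
    (fun z hz => (hω z hz N hN).1) fun U hU y hy => ?_
  obtain ⟨z, hz⟩ := hDne
  have hFlim := ((hω z hz N hN).2).mono_left hU
  have hzmin := hDS hz
  -- sublevel sets are weakly closed
  have hle : objective f g y ≤ objective f g z := by
    refine EReal.le_of_forall_lt_iff_le.1 fun a ha => ?_
    rw [objective_eq_coe hs.proper (argmin_ne_top hs.proper hzmin)] at ha
    have ha' : realObjective f g z < a := by exact_mod_cast ha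
    refine mem_of_weak_tendsto (l := (U : Filter ℕ)) (C := {x | objective f g x ≤ a})
      (convex_sublevel_objective hs.convexOn hs.proper hs.convexFun a)
      ((lowerSemicontinuous_objective hs.differentiable.continuous hs.lsc).isClosed_preimage _)
      ?_ hy
    filter_upwards [hFlim.eventually_lt_const ha', hU (eventually_ge_atTop N)] with k hk hkN
    have hd : ∀ j, g j (X w k j) ≠ ⊤ := fun j =>
      (hX w).ne_top_of_le hs.proper hs.convexFun hs.lsc hs.step_pos hkN (hN j)
    rw [objective_eq_coe hs.proper hd]
    exact_mod_cast hk.le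
  exact fun v => hle.trans (hzmin v)

/-- The expected augmented objective values are nonincreasing and have a summable gap. -/
theorem integral_augmented_bound (hX : ∀ w, IsAsyncFB f g γ d x0 w (X w))
    (hs : Setting f g K L γ p pm pM c δ τ d) (hi : ∀ k, Measurable (i k))
    (hindep : iIndepFun i P) (hlaw : ∀ k j, P.real {ω | i k ω = j} = p j) {z : PiLp 2 E}
    (hz : z ∈ argmin (objective f g)) (hx0 : ∀ j, g j (x0 j) ≠ ⊤) :
    Antitone (fun k => ∫ ω, augmented f g K c τ (X fun l => i l ω) k ∂P) ∧
    (∀ k, realObjective f g z ≤ ∫ ω, augmented f g K c τ (X fun l => i l ω) k ∂P) ∧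
    ∀ n, ∑ k ∈ Finset.range n,
        (∫ ω, augmented f g K c τ (X fun l => i l ω) (k + 1) ∂P - realObjective f g z)
      ≤ 1 / 2 * ∑ l, 1 / (γ l * p l) * ‖x0 l - z l‖ ^ 2
        + lyapunovConst pm c δ τ * (realObjective f g x0 - realObjective f g z) := by
  obtain ⟨ω0⟩ : Nonempty Ω := P.nonempty_of_neZero
  have j0 : Fin m := i 0 ω0
  have hzd := argmin_ne_top hs.proper hz
  set Fz := realObjective f g z with hFz
  have hdom : ∀ k w j, g j (X w k j) ≠ ⊤ := fun k w j =>
    (hX w).ne_top_of_le hs.proper hs.convexFun hs.lsc hs.step_pos (Nat.zero_le k)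
      (by rw [(hX w).1]; exact hx0 j)
  set V : ℕ → (ℕ → Fin m) → ℝ := fun k w => lyapunov f g K γ p pm c δ τ z (X w) k with hV
  set Ψ : ℕ → (ℕ → Fin m) → ℝ := fun k w => augmented f g K c τ (X w) k with hΨ
  have hVdep : ∀ k, DependsOn (V k) (Set.Iio k) := fun k =>
    dependsOn_trajectory hX k fun x y h => lyapunov_congr h
  have hΨdep : ∀ k, DependsOn (Ψ k) (Set.Iio k) := fun k =>
    dependsOn_trajectory hX k fun x y h => augmented_congr h
  have hVint := fun k => integrable_of_dependsOn (P := P) hi (hVdep k)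
  have hΨint := fun k => integrable_of_dependsOn (P := P) hi (hΨdep k)
  have hVint' := fun k => integrable_of_dependsOn (P := P) hi
    (dependsOn_expect (p := p) (hVdep (k + 1)))
  have hΨint' := fun k => integrable_of_dependsOn (P := P) hi
    (dependsOn_expect (p := p) (hΨdep (k + 1)))
  have hstep := fun w k => expect_lyapunov_le hX hs hzd w k (hdom k w)
  refine ⟨antitone_nat_of_succ_le fun k => ?_, fun k => ?_, fun n => ?_⟩
  · rw [integral_expect hi hindep hlaw (hΨdep (k + 1))]
    exact integral_mono (hΨint' k) (hΨint k) fun ω => (hstep _ k).1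
  · have h : ∫ _, Fz ∂P ≤ ∫ ω, Ψ k (fun l => i l ω) ∂P :=
      integral_mono (integrable_const _) (hΨint k) fun ω =>
        (realObjective_argmin_le hs.proper hz (hdom k _)).trans
          (hs.realObjective_le_augmented _ k)
    simpa using h
  · have hE : ∀ k, ∫ ω, V (k + 1) (fun l => i l ω) ∂P ≤ ∫ ω, V k (fun l => i l ω) ∂P
        - (∫ ω, Ψ (k + 1) (fun l => i l ω) ∂P - Fz) := by
      intro k
      rw [integral_expect hi hindep hlaw (hVdep (k + 1)),
        integral_expect hi hindep hlaw (hΨdep (k + 1))]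
      have h1 : ∫ ω, (V k (fun l => i l ω) - (expect p k (Ψ (k + 1)) (fun l => i l ω) - Fz)) ∂P
          = ∫ ω, V k (fun l => i l ω) ∂P
            - (∫ ω, expect p k (Ψ (k + 1)) (fun l => i l ω) ∂P - Fz) := by
        have hsub : Integrable (fun ω => expect p k (Ψ (k + 1)) (fun l => i l ω) - Fz) P :=
          (hΨint' k).sub (integrable_const _)
        rw [integral_sub (hVint k) hsub, integral_sub (hΨint' k) (integrable_const _)]
        simp
      rw [← h1]
      exact integral_mono (hVint' k)
        ((hVint k).sub ((hΨint' k).sub (integrable_const _))) fun ω => (hstep _ k).2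
    have hsum : ∫ ω, V n (fun l => i l ω) ∂P
        + ∑ k ∈ Finset.range n, (∫ ω, Ψ (k + 1) (fun l => i l ω) ∂P - Fz)
        ≤ ∫ ω, V 0 (fun l => i l ω) ∂P := by
      induction n with
      | zero => simp
      | succ n ih =>
        rw [Finset.sum_range_succ]
        have := hE n
        linarith
    have hV0 : ∫ ω, V 0 (fun l => i l ω) ∂P = 1 / 2 * ∑ l, 1 / (γ l * p l) * ‖x0 l - z l‖ ^ 2
        + lyapunovConst pm c δ τ * (realObjective f g x0 - Fz) := by
      have : ∀ w, V 0 w = 1 / 2 * ∑ l, 1 / (γ l * p l) * ‖x0 l - z l‖ ^ 2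
          + lyapunovConst pm c δ τ * (realObjective f g x0 - Fz) := by
        intro w
        simp only [hV, lyapunov, augmented, windowWeighted_zero, (hX w).1, mul_zero, add_zero]
        rfl
      simp [this]
    have hVn : 0 ≤ ∫ ω, V n (fun l => i l ω) ∂P :=
      integral_nonneg fun ω => hs.lyapunov_nonneg hz (hdom n _) j0
    linarith

/-- A nonincreasing nonnegative sequence with bounded partial sums is `o(1/k)`. -/
theorem isLittleO_one_div_of_antitone {a : ℕ → ℝ} (ha : Antitone a) (h0 : ∀ k, 0 ≤ a k) {B : ℝ}
    (hB : ∀ n, ∑ k ∈ Finset.range n, a (k + 1) ≤ B) : a =o[atTop] fun k : ℕ => 1 / (k : ℝ) := by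
  have hsum : Summable a := (summable_nat_add_iff 1).1
    (summable_of_sum_range_le (fun k => h0 (k + 1)) hB)
  have hS := hsum.hasSum.tendsto_sum_nat
  have hhalf : Tendsto (fun k : ℕ => k / 2) atTop atTop :=
    Nat.tendsto_div_const_atTop two_ne_zero
  have hlim : Tendsto (fun k : ℕ => 2 * (∑ l ∈ Finset.range k, a l
      - ∑ l ∈ Finset.range (k / 2), a l)) atTop (𝓝 0) := by
    simpa using (hS.sub (hS.comp hhalf)).const_mul 2
  have hle : ∀ k : ℕ, (k : ℝ) * a k ≤ 2 * (∑ l ∈ Finset.range k, a l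
      - ∑ l ∈ Finset.range (k / 2), a l) := by
    intro k
    rw [← Finset.sum_Ico_eq_sub _ (Nat.div_le_self k 2)]
    have h1 : ((Finset.Ico (k / 2) k).card : ℝ) * a k ≤ ∑ l ∈ Finset.Ico (k / 2) k, a l := by
      rw [← nsmul_eq_mul]
      exact Finset.card_nsmul_le_sum _ _ _ fun l hl => ha (Finset.mem_Ico.1 hl).2.le
    have h2 : (k : ℝ) ≤ 2 * ((Finset.Ico (k / 2) k).card : ℝ) := by
      rw [Nat.card_Ico]
      exact_mod_cast (by omega : k ≤ 2 * (k - k / 2))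
    have := mul_le_mul_of_nonneg_right h2 (h0 k)
    linarith
  have hka : Tendsto (fun k : ℕ => (k : ℝ) * a k) atTop (𝓝 0) :=
    squeeze_zero (fun k => mul_nonneg (Nat.cast_nonneg k) (h0 k)) hle hlim
  rw [Asymptotics.isLittleO_iff_tendsto']
  · refine hka.congr fun k => ?_
    rw [div_div_eq_mul_div, div_one, mul_comm]
  · filter_upwards [eventually_ge_atTop 1] with k hk h
    have : (0 : ℝ) < k := by exact_mod_cast hk
    exact absurd h (by positivity)

end Convergence

end AsyncFB

theorem theorem3p1 {m : ℕ} {E : Fin m → Type*}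
    [∀ i, NormedAddCommGroup (E i)] [∀ i, InnerProductSpace ℝ (E i)]
    [∀ i, CompleteSpace (E i)] [∀ i, TopologicalSpace.SeparableSpace (E i)]
    {Ω : Type*} [MeasurableSpace Ω] (P : Measure Ω) [IsProbabilityMeasure P]
    -- the smooth part
    (f : PiLp 2 E → ℝ) (hf : ConvexOn ℝ Set.univ f) (hfd : Differentiable ℝ f)
    -- the separable nonsmooth part
    (g : (i : Fin m) → E i → EReal) (hg : ∀ i, AsyncFB.Proper (g i))
    (hgc : ∀ i, AsyncFB.ConvexFun (g i)) (hgl : ∀ i, LowerSemicontinuous (g i))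
    -- blockwise Lipschitz continuity of the gradient and of its blocks
    (Lres : ℝ≥0) (hLres : 0 < Lres)
    (hfres : ∀ (x : PiLp 2 E) (i : Fin m),
      LipschitzWith Lres fun v : E i => ∇ f (AsyncFB.setBlock x i v))
    (L : Fin m → ℝ≥0)
    (hfL : ∀ (x : PiLp 2 E) (i : Fin m),
      LipschitzWith (L i) fun v : E i => (∇ f (AsyncFB.setBlock x i v)) i)
    -- the objective attains its minimum
    (hmin : (AsyncFB.argmin (AsyncFB.objective f g)).Nonempty)
    -- i.i.d. random blocks with positive probabilities
    (i : ℕ → Ω → Fin m) (hi : ∀ k, Measurable (i k)) (hindep : iIndepFun i P)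
    (p : Fin m → ℝ) (hp : ∀ j, 0 < p j) (hlaw : ∀ k j, P.real {ω | i k ω = j} = p j)
    -- bounded delays
    (τ : ℕ) (d : ℕ → Fin m → ℕ) (hd : ∀ k j, d k j ≤ min k τ)
    -- stepsizes
    (γ : Fin m → ℝ) (hγ : ∀ j, 0 < γ j) (hδ : AsyncFB.delta L Lres γ p τ < 2)
    -- the iterates
    (x0 : PiLp 2 E) (x : ℕ → Ω → PiLp 2 E)
    (hx : ∀ ω, AsyncFB.IsAsyncFB f g γ d x0 (fun k => i k ω) (fun k => x k ω)) :
    -- almost sure weak convergence to a random variable with values in `argmin F`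
    (∃ xlim : Ω → PiLp 2 E, StronglyMeasurable xlim ∧
      (∀ ω, xlim ω ∈ AsyncFB.argmin (AsyncFB.objective f g)) ∧
      ∀ᵐ ω ∂P, Tendsto (fun k => toWeakSpace ℝ (PiLp 2 E) (x k ω)) atTop
        (𝓝 (toWeakSpace ℝ (PiLp 2 E) (xlim ω)))) ∧
    -- rates for the function values, when the starting point lies in the domain of `F`
    (AsyncFB.objective f g x0 ≠ ⊤ →
      (∀ k ω, AsyncFB.objective f g (x k ω) ≠ ⊤) ∧
      (∀ k, Integrable (fun ω => (AsyncFB.objective f g (x k ω)).toReal) P) ∧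
      ((fun k : ℕ => (∫ ω, (AsyncFB.objective f g (x k ω)).toReal ∂P)
          - AsyncFB.minValue (AsyncFB.objective f g)) =o[atTop] fun k : ℕ => 1 / (k : ℝ)) ∧
      ∀ k : ℕ, 1 ≤ k →
        (∫ ω, (AsyncFB.objective f g (x k ω)).toReal ∂P)
            - AsyncFB.minValue (AsyncFB.objective f g) ≤
          1 / (k : ℝ) *
            (AsyncFB.weightedDist (fun j => 1 / (γ j * p j)) x0
                (AsyncFB.argmin (AsyncFB.objective f g)) ^ 2 / 2
              + AsyncFB.rateConst (AsyncFB.delta L Lres γ p τ) p τ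
                * ((AsyncFB.objective f g x0).toReal
                    - AsyncFB.minValue (AsyncFB.objective f g)))) := by
  open AsyncFB in
  obtain ⟨ω0⟩ : Nonempty Ω := P.nonempty_of_neZero
  have hne : Nonempty (Fin m) := ⟨i 0 ω0⟩
  -- the parameters
  have hple : ∀ j, pmin p ≤ p j := fun j => ciInf_le (Set.finite_range p).bddBelow j
  have hpge : ∀ j, p j ≤ pmax p := fun j => le_ciSup (Set.finite_range p).bddAbove j
  have hpm : 0 < pmin p := by
    obtain ⟨j, hj⟩ := exists_eq_ciInf_of_finite (f := p)
    rw [pmin, ← hj]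
    exact hp j
  have hpmM : pmin p ≤ pmax p := (hple (i 0 ω0)).trans (hpge _)
  have hsq : 0 < √(pmin p) := Real.sqrt_pos.2 hpm
  have hp1 : ∑ j, p j = 1 := by
    have h := integral_expect (P := P) hi hindep hlaw (k := 0) (Y := fun _ => (1 : ℝ))
      (fun _ _ _ => rfl)
    simpa [expect] using h.symm
  have hs : Setting f g Lres L γ p (pmin p) (pmax p) (pmax p / √(pmin p))
      (delta L Lres γ p τ) τ d :=
    { convexOn := hf
      differentiable := hfd
      proper := hg
      convexFun := hgc
      lsc := hgl
      lipschitz := hfres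
      lipschitz_block := hfL
      step_pos := hγ
      sum_prob := hp1
      pm_pos := hpm
      pm_le := hple
      le_pM := hpge
      c_pos := div_pos (hpm.trans_le hpmM) hsq
      sqrt_pm_le := by
        rw [le_div_iff₀ hsq, Real.mul_self_sqrt hpm.le]
        exact hpmM
      pM_le := by
        rw [div_pow, Real.sq_sqrt hpm.le, le_div_iff₀ hpm, sq]
        exact mul_le_mul_of_nonneg_left hpmM (hpm.le.trans hpmM)
      δ_lt := hδ
      le_δ := fun j => by
        have := le_ciSup (Set.finite_range fun j => (L j : ℝ) * γ j
          + 2 * γ j * τ * Lres * (pmax p / √(pmin p))).bddAbove j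
        exact this
      delay := hd }
  -- the iterates as functions of the index sequence
  choose X hX using exists_isAsyncFB f g γ d x0
  have hxX : ∀ k ω, x k ω = X (fun l => i l ω) k := fun k ω =>
    (hx ω).congr (hX fun l => i l ω) k (fun _ _ => rfl) k le_rfl
  simp only [hxX]
  constructor
  · have hae := ae_exists_weak_limit (P := P) hX hs hi hindep hlaw hmin
    obtain ⟨G, hGmem, hG, hGsub⟩ := hae.exists_measurable_mem
    obtain ⟨z, hz⟩ := hmin
    have hchoice : ∀ ω, ∃ y ∈ argmin (objective f g), (ω ∉ G → y = z) ∧ (ω ∈ G → ∀ u,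
        Tendsto (fun k => inner ℝ u (X (fun l => i l ω) k)) atTop (𝓝 (inner ℝ u y))) := by
      intro ω
      by_cases hω : ω ∈ G
      · obtain ⟨y, hy, hlim⟩ := hGsub ω hω
        exact ⟨y, hy, fun h => absurd hω h, fun _ => hlim⟩
      · exact ⟨z, hz, fun _ => rfl, fun h => absurd h hω⟩
    choose xlim hxmem hxout hxlim using hchoice
    have (i : Fin m) : SecondCountableTopology (E i) := UniformSpace.secondCountable_of_separable _
    refine ⟨xlim, stronglyMeasurable_of_inner fun u => ?_, hxmem, ?_⟩
    · classical
      have hmeas : ∀ k, Measurable fun ω =>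
          if ω ∈ G then inner ℝ u (X (fun l => i l ω) k) else inner ℝ u z := by
        intro k
        refine Measurable.ite hG ?_ measurable_const
        exact (measurable_of_dependsOn hi (dependsOn_trajectory hX k (Φ := fun x => inner ℝ u (x k))
          fun x y h => by rw [h k le_rfl])).mono ((historyFiltration hi).le k) le_rfl
      refine measurable_of_tendsto_metrizable hmeas (tendsto_pi_nhds.2 fun ω => ?_)
      by_cases hω : ω ∈ G
      · simpa only [if_pos hω] using hxlim ω hω u
      · simp only [if_neg hω, hxout ω hω]
        exact tendsto_const_nhds
    · filter_upwards [hGmem] with ω hω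
      exact tendsto_toWeakSpace_iff.2 (hxlim ω hω)
  · intro hx0
    have hx0d := (objective_ne_top_iff hg).1 hx0
    have hdom : ∀ k ω j, g j (X (fun l => i l ω) k j) ≠ ⊤ := fun k ω j =>
      (hX _).ne_top_of_le hg hgc hgl hγ (Nat.zero_le k) (by rw [(hX _).1]; exact hx0d j)
    have hreal : ∀ k ω, (objective f g (X (fun l => i l ω) k)).toReal
        = realObjective f g (X (fun l => i l ω) k) := fun k ω => by
      rw [objective_eq_coe hg (hdom k ω), EReal.toReal_coe]
    have hFint : ∀ k, Integrable (fun ω => realObjective f g (X (fun l => i l ω) k)) P := fun k =>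
      integrable_of_dependsOn hi (dependsOn_trajectory hX k
        (Φ := fun x => realObjective f g (x k)) fun x y h => by rw [h k le_rfl])
    simp only [hreal]
    set c := pmax p / √(pmin p) with hc
    set Ψ : ℕ → ℝ := fun k => ∫ ω, augmented f g Lres c τ (X fun l => i l ω) k ∂P with hΨ
    have hFΨ : ∀ k, ∫ ω, realObjective f g (X (fun l => i l ω) k) ∂P ≤ Ψ k := fun k =>
      integral_mono (hFint k) (integrable_of_dependsOn hi
        (dependsOn_trajectory hX k fun x y h => augmented_congr h))
        fun ω => hs.realObjective_le_augmented _ k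
    have hbound := fun z hz =>
      integral_augmented_bound (P := P) (z := z) hX hs hi hindep hlaw hz hx0d
    have hF : ∀ z ∈ argmin (objective f g), ∀ k,
        realObjective f g z ≤ ∫ ω, realObjective f g (X (fun l => i l ω) k) ∂P := by
      intro z hz k
      have h : ∫ _, realObjective f g z ∂P ≤ ∫ ω, realObjective f g (X (fun l => i l ω) k) ∂P :=
        integral_mono (integrable_const _) (hFint k) fun ω =>
          realObjective_argmin_le hg hz (hdom k ω)
      simpa using h
    refine ⟨fun k ω => (objective_ne_top_iff hg).2 (hdom k ω), hFint, ?_, ?_⟩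
    · obtain ⟨z, hz⟩ := hmin
      obtain ⟨hanti, hge, hsum⟩ := hbound z hz
      rw [minValue_eq hg hz]
      have ho := isLittleO_one_div_of_antitone (a := fun k => Ψ k - realObjective f g z)
        (fun k l hkl => sub_le_sub_right (hanti hkl) _) (fun k => sub_nonneg.2 (hge k)) hsum
      refine Asymptotics.IsBigO.trans_isLittleO (Asymptotics.IsBigO.of_bound 1
        (Eventually.of_forall fun k => ?_)) ho
      rw [one_mul, Real.norm_of_nonneg (sub_nonneg.2 (hF z hz k)),
        Real.norm_of_nonneg (sub_nonneg.2 (hge k))]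
      exact sub_le_sub_right (hFΨ k) _
    · intro k hk
      have hk0 : (0 : ℝ) < k := by exact_mod_cast hk
      obtain ⟨z0, hz0⟩ := hmin
      rw [objective_eq_coe hg hx0d, EReal.toReal_coe, minValue_eq hg hz0]
      set EF := ∫ ω, realObjective f g (X (fun l => i l ω) k) ∂P with hEF
      set B := 2 * (k * (EF - realObjective f g z0)
        - lyapunovConst (pmin p) c (delta L Lres γ p τ) τ
          * (realObjective f g x0 - realObjective f g z0)) with hB
      -- the bound holds with every minimizer in place of the projection of `x0`
      have hBz : ∀ z ∈ argmin (objective f g),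
          B ≤ weightedNorm (fun j => 1 / (γ j * p j)) (x0 - z) ^ 2 := by
        intro z hz
        obtain ⟨hanti, -, hsum⟩ := hbound z hz
        have hzz : realObjective f g z = realObjective f g z0 := by
          rw [← minValue_eq hg hz, minValue_eq hg hz0]
        have h1 : (k : ℝ) * (Ψ k - realObjective f g z)
            ≤ ∑ l ∈ Finset.range k, (Ψ (l + 1) - realObjective f g z) := by
          have := Finset.card_nsmul_le_sum (Finset.range k)
            (fun l => Ψ (l + 1) - realObjective f g z) (Ψ k - realObjective f g z)
            fun l hl => sub_le_sub_right (hanti (Finset.mem_range.1 hl)) _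
          simpa using this
        have h2 : (k : ℝ) * (EF - realObjective f g z) ≤ k * (Ψ k - realObjective f g z) :=
          mul_le_mul_of_nonneg_left (sub_le_sub_right (hFΨ k) _) hk0.le
        have h3 := hsum k
        rw [weightedNorm, Real.sq_sqrt (Finset.sum_nonneg fun j _ => by
          have := hγ j; have := hp j; positivity)]
        simp only [PiLp.sub_apply]
        rw [hB, ← hzz]
        linarith
      have hdist : B ≤ weightedDist (fun j => 1 / (γ j * p j)) x0 (argmin (objective f g)) ^ 2 := by
        have hnonempty : Nonempty (argmin (objective f g)) := ⟨⟨z0, hz0⟩⟩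
        rcases le_or_gt B 0 with hB0 | hB0
        · exact hB0.trans (sq_nonneg _)
        · have h1 : √B ≤ weightedDist (fun j => 1 / (γ j * p j)) x0 (argmin (objective f g)) :=
            le_ciInf fun z => Real.sqrt_le_iff.2 ⟨Real.sqrt_nonneg _, hBz z z.2⟩
          calc B = √B ^ 2 := (Real.sq_sqrt hB0.le).symm
            _ ≤ _ := by gcongr
      have hconst : rateConst (delta L Lres γ p τ) p τ
          = lyapunovConst (pmin p) c (delta L Lres γ p τ) τ := rfl
      rw [hconst, one_div, inv_mul_eq_div, le_div_iff₀ hk0]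
      rw [hB] at hdist
      linarith
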